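/- **Theorem 6.1.** Let $\mathbf{k}$ be a field. A planar binary tree is either the tree $|$ with no vertex, or $S\vee T$ for planar binary trees $S,T$ (grafted on the left and right leaf of the tree $Y=|\vee|$ with one vertex); its degree is its number of vertices. Let $\mathbb{Y}(n)$ be the finite set of planar binary trees of degree $n$, and $\mathcal{Y}(n)=\mathbf{k}\mathbb{Y}(n)$. *The dendriform operad.* The spaces $\mathcal{Y}(n)$, $n\ge 1$, form the dendriform operad $\mathcal{Y}$, the non-symmetric operad with unit $Y$ generated by two binary operations $\prec,\succ$ with relations $(x\prec y)\prec z=x\prec(y\prec z+y\succ z)$, $\ x\succ(y\prec z)=(x\succ y)\prec z$, $\ x\succ(y\succ z)=(x\succ y+x\prec y)\succ z$. Here $\prec$ is the tree $|\vee(|\vee|)$, $\succ$ is the tree $(|\vee|)\vee|$, and the dendriform operations on trees are $(a\vee b)\prec T=a\vee(b*T)$ and $S\succ(c\vee d)=(S*c)\vee d$, where $*$ is bilinear with unit $|$ and $S*T=S\prec T+S\succ T$ for $S,T\neq|$. A tree $T=l\vee r$ with $l$ of degree $p$ stands for the operation $T(x_1,\dots,x_n)=l(x_1,\dots,x_p)\succ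 x_{p+1}\prec r(x_{p+2},\dots,x_n)$ (a factor is omitted if it is $|$), and $T\circ_i S=T(Y,\dots,Y,S,Y,\dots,Y)$ with $S$ at the place $i$. *The anticyclic structure.* There is exactly one family of linear maps $\tau:\mathcal{Y}(n)\to\mathcal{Y}(n)$, $n\ge 1$, such that $\tau^{n+1}=\mathrm{Id}$ on $\mathcal{Y}(n)$, $\tau(Y)=-Y$, for all $a\in\mathcal{Y}(n)$, $b\in\mathcal{Y}(m)$ $$\tau(a\circ_n b)=-\tau(b)\circ_1\tau(a),\qquad \tau(a\circ_i b)=\tau(a)\circ_{i+1}b\quad(1\le i<n),$$ and $\tau(\prec)=\ \succ$, $\ \tau(\succ)=-(\prec+\succ)$. *The Coxeter transformation.* Let $\mathbb{T}(n)$ be the Tamari poset: the set $\mathbb{Y}(n)$ with the reflexive and transitive closure $\le$ of the relations "$T$ is obtained from $S$ by replacing a subtree $(a\vee b)\vee c$ by $a\vee(b\vee c)$". Let $L$ be its incidence matrix, $L_{S,T}=1$ if $S\le T$ and $L_{S,T}=0$ otherwise, and let $\theta$ be the Coxeter transformation of $\mathbb{T}(n)$, that is, the endomorphism of $\mathcal{Y}(n)$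 whose matrix in the basis $\mathbb{Y}(n)$ (acting on column vectors) is $-L(L^t)^{-1}$. Then, for every $n\ge 1$, on $\mathcal{Y}(n)$ $$\tau=(-1)^n\theta^2 .$$ -/

import Mathlib

open scoped BinaryTree

noncomputable section

namespace DendTamari

/-- Planar binary trees. `BinaryTree.nil` is the tree `|` without vertex; `S △ T` is the tree
obtained by grafting `S` and `T` on the left and right leaf of the tree with one vertex.
The degree of a tree is `BinaryTree.numNodes`. -/
abbrev PTree : Type := BinaryTree Unit

/-! ### Tamari posets -/

/-- Covering relations of the Tamari order: `S` is covered by `T` if `T` is obtained from `S` by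
one rotation `(a △ b) △ c ↦ a △ (b △ c)` at some place in the tree. -/
inductive TamariCover : PTree → PTree → Prop
  | rotate (a b c : PTree) : TamariCover ((a △ b) △ c) (a △ (b △ c))
  | left {l l' : PTree} (r : PTree) : TamariCover l l' → TamariCover (l △ r) (l' △ r)
  | right (l : PTree) {r r' : PTree} : TamariCover r r' → TamariCover (l △ r) (l △ r')

/-- The set of planar binary trees of degree `n`. -/
def TreeOfDegree (n : ℕ) : Type := {T : PTree // T ∈ {T : PTree | T.numNodes = n}}

instance (n : ℕ) : Fintype (TreeOfDegree n) :=
  Fintype.subtype (BinaryTree.treesOfNumNodesEq n)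
    (fun _ => BinaryTree.mem_treesOfNumNodesEq)

instance (n : ℕ) : DecidableEq (TreeOfDegree n) :=
  inferInstanceAs (DecidableEq {T : PTree // T ∈ {T : PTree | T.numNodes = n}})

/-- An auxiliary statistic, strictly increasing along rotations. -/
def rightWeight : PTree → ℕ
  | .nil => 0
  | .node _ l r => rightWeight l + rightWeight r + r.numNodes

theorem TamariCover.numNodes_eq {S T : PTree} (h : TamariCover S T) :
    S.numNodes = T.numNodes := by
  induction h with
  | rotate a b c => simp only [BinaryTree.numNodes]; omega
  | left r _ ih => simp only [BinaryTree.numNodes, ih]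
  | right l _ ih => simp only [BinaryTree.numNodes, ih]

theorem TamariCover.rightWeight_lt {S T : PTree} (h : TamariCover S T) :
    rightWeight S < rightWeight T := by
  induction h with
  | rotate a b c => simp only [rightWeight, BinaryTree.numNodes]; omega
  | left r _ ih => simp only [rightWeight]; omega
  | right l h ih => simp only [rightWeight, h.numNodes_eq]; omega

theorem eq_or_rightWeight_lt {S T : PTree} (h : Relation.ReflTransGen TamariCover S T) :
    S = T ∨ rightWeight S < rightWeight T := by
  induction h with
  | refl => exact Or.inl rfl
  | tail _ h ih =>
    right
    rcases ih with rfl | ih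
    · exact h.rightWeight_lt
    · exact ih.trans h.rightWeight_lt

/-- The Tamari poset of degree `n`: the order is the reflexive and transitive closure of the
covering relations. -/
instance (n : ℕ) : PartialOrder (TreeOfDegree n) where
  le S T := Relation.ReflTransGen TamariCover S.1 T.1
  le_refl _ := Relation.ReflTransGen.refl
  le_trans _ _ _ := Relation.ReflTransGen.trans
  le_antisymm S T h h' := by
    apply Subtype.ext
    rcases eq_or_rightWeight_lt h with h | h
    · exact h
    · rcases eq_or_rightWeight_lt h' with h' | h'
      · exact h'.symm
      · omega

/-! ### Zeta matrix of a finite poset and its Coxeter matrix -/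

section Coxeter

variable (k : Type*) [Field k] (P : Type*) [PartialOrder P] [Fintype P] [DecidableEq P]

open Classical in
/-- The incidence matrix `L` of a poset: `L v w = 1` if `v ≤ w`, and `0` otherwise. -/
def zetaMatrix : Matrix P P k := Matrix.of fun v w => if v ≤ w then 1 else 0

/-- The matrix `L` is unitriangular for a linear extension, so the inverse of its transpose that
is used below is a true inverse. -/
theorem det_zetaMatrix : (zetaMatrix k P).det = 1 := by
  classical
  let e : LinearExtension P ≃ P := Equiv.refl P
  let F : Fintype (LinearExtension P) := Fintype.ofEquiv P e.symm
  have hM : ((zetaMatrix k P).submatrix e e).BlockTriangular id := by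
    intro i j hij
    change (if e i ≤ e j then (1 : k) else 0) = 0
    rw [if_neg]
    intro h
    exact absurd (toLinearExtension.monotone h) (not_le_of_gt hij)
  rw [← Matrix.det_submatrix_equiv_self e, Matrix.det_of_isUpperTriangular hM]
  refine Finset.prod_eq_one fun i _ => ?_
  change (if e i ≤ e i then (1 : k) else 0) = 1
  exact if_pos le_rfl

/-- The matrix `-L (Lᵗ)⁻¹` of the Coxeter transformation of a finite poset in the basis of
(classes of) simple modules, which is indexed by the elements of the poset. It sends the class
`Lᵗ e_v` of the projective cover of the simple module at `v` to minus the class `L e_v` of its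
injective hull. -/
def coxeterMatrix : Matrix P P k := -(zetaMatrix k P * (zetaMatrix k P).transpose⁻¹)

end Coxeter

/-! ### Dendriform operations on planar binary trees -/

section Dendriform

variable (k : Type*) [Field k]

/-- The vector space spanned by all planar binary trees, with basis
`Finsupp.single T 1` for `T` a tree. -/
abbrev TreeSpace : Type _ := PTree →₀ k

/-- The bilinear extension of an operation defined on trees. -/
def bilin (f : PTree → PTree → TreeSpace k) : TreeSpace k →ₗ[k] TreeSpace k →ₗ[k] TreeSpace k :=
  Finsupp.linearCombination k fun S => Finsupp.linearCombination k fun T => f S T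

/-- The bilinear extension of `(S, T) ↦ S △ T`. -/
def graft : TreeSpace k →ₗ[k] TreeSpace k →ₗ[k] TreeSpace k :=
  bilin k fun S T => Finsupp.single (S △ T) 1

/-- The associative product `*` of two trees, with unit `|` and
`(a △ b) * (c △ d) = ((a △ b) * c) △ d + a △ (b * (c △ d))`. -/
def mulTree : PTree → PTree → TreeSpace k
  | .nil, T => Finsupp.single T 1
  | .node _ a b, .nil => Finsupp.single (a △ b) 1
  | .node _ a b, .node _ c d =>
      graft k (mulTree (a △ b) c) (Finsupp.single d 1) +
        graft k (Finsupp.single a 1) (mulTree b (c △ d))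
  termination_by S T => S.numNodes + T.numNodes
  decreasing_by
    all_goals simp only [BinaryTree.numNodes]; omega

/-- The dendriform operation `≺`: `(a △ b) ≺ T = a △ (b * T)`. In particular `S ≺ | = S`. The
value at `S = |` is a convention and is not used. -/
def precTree : PTree → PTree → TreeSpace k
  | .nil, _ => 0
  | .node _ a b, T => graft k (Finsupp.single a 1) (mulTree k b T)

/-- The dendriform operation `≻`: `S ≻ (c △ d) = (S * c) △ d`. In particular `| ≻ T = T`. The
value at `T = |` is a convention and is not used. -/
def succTree : PTree → PTree → TreeSpace k
  | _, .nil => 0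
  | S, .node _ c d => graft k (mulTree k S c) (Finsupp.single d 1)

/-- `≺`, extended bilinearly. -/
def prec : TreeSpace k →ₗ[k] TreeSpace k →ₗ[k] TreeSpace k := bilin k (precTree k)

/-- `≻`, extended bilinearly. -/
def succ : TreeSpace k →ₗ[k] TreeSpace k →ₗ[k] TreeSpace k := bilin k (succTree k)

/-! ### The dendriform operad -/

/-- The composition `x ↦ T ∘_i x` of the dendriform operad. The vertices of `T` are numbered from
`1` to the degree of `T`, from left to right (in-order).

The tree `l △ r` is `l ≻ Y ≺ r` in the free dendriform algebra on the generator `Y`. So, as an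
operation in the dendriform operad, a tree `T` of degree `n` is the operation
`T(x₁, …, xₙ) = l(x₁, …, xₚ) ≻ xₚ₊₁ ≺ r(xₚ₊₂, …, xₙ)` for `T = l △ r` with `l` of degree `p`, and
`T ∘_i x` is the element `T(Y, …, Y, x, Y, …, Y)` with `x` at the place `i`. (If there is no
vertex number `i`, the value is `0` by convention.) -/
def compTree : PTree → ℕ → TreeSpace k →ₗ[k] TreeSpace k
  | .nil, _ => 0
  | .node _ l r, i =>
      if i ≤ l.numNodes then
        (graft k).flip (Finsupp.single r 1) ∘ₗ compTree l i
      else if i = l.numNodes + 1 then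
        (prec k).flip (Finsupp.single r 1) ∘ₗ succ k (Finsupp.single l 1)
      else
        graft k (Finsupp.single l 1) ∘ₗ compTree r (i - (l.numNodes + 1))

/-- The partial composition `a ∘_i b`, bilinear in `a` and `b`. -/
def compTotal (i : ℕ) : TreeSpace k →ₗ[k] TreeSpace k →ₗ[k] TreeSpace k :=
  Finsupp.linearCombination k fun T => compTree k T i

/-- The space `𝒴(n)` spanned by the planar binary trees of degree `n`. -/
def Dend (n : ℕ) : Submodule k (TreeSpace k) :=
  Finsupp.supported k k {T : PTree | T.numNodes = n}

/-- The element of `𝒴(n)` given by a tree of degree `n`. -/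
def ofTree {n : ℕ} (T : PTree) (hT : T.numNodes = n) : Dend k n :=
  ⟨Finsupp.single T 1, Finsupp.single_mem_supported k 1 hT⟩

/-- The basis of `𝒴(n)` consisting of the planar binary trees of degree `n`. -/
def treeBasis (n : ℕ) : Module.Basis (TreeOfDegree n) k (Dend k n) :=
  Module.Basis.ofRepr (Finsupp.supportedEquivFinsupp {T : PTree | T.numNodes = n})

theorem treeBasis_apply (n : ℕ) (T : TreeOfDegree n) :
    treeBasis k n T = ofTree k T.1 T.2 := by
  apply Subtype.ext
  simp only [treeBasis, ofTree]
  exact Finsupp.supportedEquivFinsupp_symm_single _ _ _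

variable {k}

theorem single_mem_Dend {n : ℕ} {T : PTree} (hT : T.numNodes = n) :
    (Finsupp.single T 1 : TreeSpace k) ∈ Dend k n :=
  Finsupp.single_mem_supported k 1 hT

theorem linearCombination_mem {n p : ℕ} {f : PTree → TreeSpace k}
    (hf : ∀ T : PTree, T.numNodes = n → f T ∈ Dend k p)
    {x : TreeSpace k} (hx : x ∈ Dend k n) : Finsupp.linearCombination k f x ∈ Dend k p := by
  rw [Finsupp.linearCombination_apply]
  exact Submodule.sum_mem _ fun T hT => Submodule.smul_mem _ _ (hf T (hx hT))

theorem linearCombination_apply_mem {n p : ℕ} {f : PTree → TreeSpace k →ₗ[k] TreeSpace k}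
    {y : TreeSpace k} (hf : ∀ T : PTree, T.numNodes = n → f T y ∈ Dend k p)
    {x : TreeSpace k} (hx : x ∈ Dend k n) : Finsupp.linearCombination k f x y ∈ Dend k p := by
  rw [Finsupp.linearCombination_apply, Finsupp.sum, LinearMap.sum_apply]
  exact Submodule.sum_mem _ fun T hT => Submodule.smul_mem _ _ (hf T (hx hT))

theorem bilin_mem {f : PTree → PTree → TreeSpace k} {n m p : ℕ}
    (hf : ∀ S T : PTree, S.numNodes = n → T.numNodes = m → f S T ∈ Dend k p)
    {x y : TreeSpace k} (hx : x ∈ Dend k n) (hy : y ∈ Dend k m) :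
    bilin k f x y ∈ Dend k p :=
  linearCombination_apply_mem
    (fun S hS => linearCombination_mem (fun T hT => hf S T hS hT) hy) hx

theorem graft_mem {n m p : ℕ} (hp : n + m + 1 = p) {x y : TreeSpace k}
    (hx : x ∈ Dend k n) (hy : y ∈ Dend k m) : graft k x y ∈ Dend k p :=
  bilin_mem (fun S T hS hT => single_mem_Dend (by simp only [BinaryTree.numNodes]; omega)) hx hy

theorem mulTree_mem (S T : PTree) : mulTree k S T ∈ Dend k (S.numNodes + T.numNodes) := by
  fun_induction mulTree k S T with
  | case1 T => exact single_mem_Dend (by simp)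
  | case2 u a b => exact single_mem_Dend (by simp)
  | case3 u a b v c d ih1 ih2 =>
    refine Submodule.add_mem _ (graft_mem ?_ ih1 (single_mem_Dend rfl))
      (graft_mem ?_ (single_mem_Dend rfl) ih2) <;>
    · simp only [BinaryTree.numNodes]; omega

theorem precTree_mem (S T : PTree) : precTree k S T ∈ Dend k (S.numNodes + T.numNodes) := by
  cases S with
  | nil => exact Submodule.zero_mem _
  | node u a b =>
    exact graft_mem (by simp only [BinaryTree.numNodes]; omega) (single_mem_Dend rfl)
      (mulTree_mem b T)

theorem succTree_mem (S T : PTree) : succTree k S T ∈ Dend k (S.numNodes + T.numNodes) := by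
  cases T with
  | nil => exact Submodule.zero_mem _
  | node u c d =>
    exact graft_mem (by simp only [BinaryTree.numNodes]; omega) (mulTree_mem S c)
      (single_mem_Dend rfl)

theorem prec_mem {n m p : ℕ} (hp : n + m = p) {x y : TreeSpace k}
    (hx : x ∈ Dend k n) (hy : y ∈ Dend k m) : prec k x y ∈ Dend k p :=
  bilin_mem (fun S T hS hT => hp ▸ hS ▸ hT ▸ precTree_mem S T) hx hy

theorem succ_mem {n m p : ℕ} (hp : n + m = p) {x y : TreeSpace k}
    (hx : x ∈ Dend k n) (hy : y ∈ Dend k m) : succ k x y ∈ Dend k p :=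
  bilin_mem (fun S T hS hT => hp ▸ hS ▸ hT ▸ succTree_mem S T) hx hy

theorem compTree_nil_apply (i : ℕ) (x : TreeSpace k) : compTree k .nil i x = 0 := by
  rw [compTree, LinearMap.zero_apply]

theorem compTree_node_apply (u : Unit) (l r : PTree) (i : ℕ) (x : TreeSpace k) :
    compTree k (.node u l r) i x =
      if i ≤ l.numNodes then graft k (compTree k l i x) (Finsupp.single r 1)
      else if i = l.numNodes + 1 then
        prec k (succ k (Finsupp.single l 1) x) (Finsupp.single r 1)
      else graft k (Finsupp.single l 1) (compTree k r (i - (l.numNodes + 1)) x) := by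
  rw [compTree]
  split_ifs
  · rw [LinearMap.comp_apply, LinearMap.flip_apply]
  · rw [LinearMap.comp_apply, LinearMap.flip_apply]
  · rw [LinearMap.comp_apply]

theorem compTree_mem {m : ℕ} {x : TreeSpace k} (hx : x ∈ Dend k (m + 1)) (T : PTree) :
    ∀ i n : ℕ, T.numNodes = n + 1 → compTree k T i x ∈ Dend k (n + m + 1) := by
  induction T with
  | nil =>
    intro i n _
    rw [compTree_nil_apply]
    exact Submodule.zero_mem _
  | node u l r ihl ihr =>
    intro i n h
    simp only [BinaryTree.numNodes] at h
    rw [compTree_node_apply]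
    split_ifs with h1 h2
    · cases l with
      | nil =>
        rw [compTree_nil_apply, map_zero, LinearMap.zero_apply]
        exact Submodule.zero_mem _
      | node v a b =>
        exact graft_mem (by simp only [BinaryTree.numNodes] at h; omega)
          (ihl i (a.numNodes + b.numNodes) rfl) (single_mem_Dend rfl)
    · exact prec_mem (by omega) (succ_mem rfl (single_mem_Dend rfl) hx) (single_mem_Dend rfl)
    · cases r with
      | nil =>
        rw [compTree_nil_apply, map_zero]
        exact Submodule.zero_mem _
      | node v a b =>
        exact graft_mem (by simp only [BinaryTree.numNodes] at h; omega) (single_mem_Dend rfl)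
          (ihr _ (a.numNodes + b.numNodes) rfl)

theorem compTotal_mem {n m : ℕ} (i : ℕ) {a b : TreeSpace k} (ha : a ∈ Dend k (n + 1))
    (hb : b ∈ Dend k (m + 1)) : compTotal k i a b ∈ Dend k (n + m + 1) :=
  linearCombination_apply_mem (fun T hT => compTree_mem hb T i n hT) ha

/-- The partial composition `∘_i : 𝒴(n + 1) × 𝒴(m + 1) → 𝒴(n + m + 1)` of the dendriform operad,
for `1 ≤ i ≤ n + 1`. -/
def comp {n m : ℕ} (i : ℕ) (a : Dend k (n + 1)) (b : Dend k (m + 1)) : Dend k (n + m + 1) :=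
  ⟨compTotal k i a.1 b.1, compTotal_mem i a.2 b.2⟩

variable (k)

/-- The unit of the dendriform operad: the tree `Y` with one vertex. -/
def unitY : Dend k 1 := ofTree k (.nil △ .nil) rfl

/-- The generator `≺ = Y ≺ Y` of the dendriform operad: the tree with two vertices whose root
vertex has the other vertex on its right. -/
def genPrec : Dend k 2 := ofTree k (.nil △ (.nil △ .nil)) rfl

/-- The generator `≻ = Y ≻ Y` of the dendriform operad: the tree with two vertices whose root
vertex has the other vertex on its left. -/
def genSucc : Dend k 2 := ofTree k ((.nil △ .nil) △ .nil) rfl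

variable {k}

/-- A structure of anticyclic non-symmetric operad on the dendriform operad; the map `τ n` acts
on `𝒴(n + 1)`, for `n ≥ 0`. -/
structure IsAnticyclic (τ : ∀ n : ℕ, Module.End k (Dend k (n + 1))) : Prop where
  pow_eq_one : ∀ n, τ n ^ (n + 2) = 1
  map_unit : τ 0 (unitY k) = -unitY k
  map_comp_last : ∀ (n m : ℕ) (a : Dend k (n + 1)) (b : Dend k (m + 1)),
    (τ (n + m) (comp (n + 1) a b) : TreeSpace k) = -(comp 1 (τ m b) (τ n a) : TreeSpace k)
  map_comp : ∀ (n m i : ℕ) (a : Dend k (n + 1)) (b : Dend k (m + 1)), 1 ≤ i → i < n + 1 →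
    τ (n + m) (comp i a b) = comp (i + 1) (τ n a) b

/-- The anticyclic structure of the dendriform operad: the anticyclic structure with
`τ(≺) = ≻` and `τ(≻) = -(≺ + ≻)`. -/
structure IsDendAnticyclic (τ : ∀ n : ℕ, Module.End k (Dend k (n + 1))) : Prop
    extends IsAnticyclic τ where
  map_prec : τ 1 (genPrec k) = genSucc k
  map_succ : τ 1 (genSucc k) = -(genPrec k + genSucc k)

variable (k)

/-- The Coxeter transformation `θ` of the Tamari poset of degree `n`, acting on `𝒴(n)`. -/
def theta (n : ℕ) : Module.End k (Dend k n) :=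
  Matrix.toLin (treeBasis k n) (treeBasis k n) (coxeterMatrix k (TreeOfDegree n))

end Dendriform

end DendTamari

end

/-! Write `/` for grafting a tree on the leftmost leaf of another, and `\` for grafting on the
rightmost leaf. Both halves of the theorem rest on one recursive formula for the anticyclic map,
extended to all trees by τ(|) = |: τ(a △ b) = -((Y * a) / τ(b)).

Uniqueness: every tree other than Y is built from smaller trees by a △ b = (a △ |) ∘_last (| △ b), a
△ | = ≻ ∘_1 a and | △ b = ≺ ∘_2 b (for a, b ≠ |). The axioms and the values on Y, ≺, ≻ then force
the formula.

Existence: the map defined by the formula satisfies the two composition axioms (`tau_compTotal`,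
`tau_compTotal_last`), because insertion at a vertex is compatible with `*` and `/`. The relation
τ^(n+1) = Id passes from a and b to a ∘_i b (`iterate_tau_compTotal_eq`), so it need only be checked
on Y, ≺ and ≻.

Comparison with θ: let U_v and D_v be the sums of the trees above and below v. Since U_v = Lᵗ e_v
and D_v = L e_v, the map c = -θ is characterised by c(U_v) = D_v. The Tamari intervals factor as
U_(l △ r) = U_l * (| △ U_r) and D_(l △ r) = (D_l △ |) * D_r, so that c(x * (| △ y)) = (c(x) △ |) *
c(y). It follows that c turns `*` into `/` and `\` into `*`, and that c(D_v △ |) = ± (| △ U_v).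
Hence c² satisfies on the U_v, up to sign, the recursion that τ satisfies there by `tau_mul_graft`.
-/

noncomputable section

namespace DendTamari

/-! ### Products on planar binary trees. -/

section Operations

variable {k : Type*} [Field k]

/-- The basis vector of the tree `T`. -/
abbrev tr (T : PTree) : TreeSpace k := Finsupp.single T 1

/-- The product `*`, extended bilinearly. -/
def mul : TreeSpace k →ₗ[k] TreeSpace k →ₗ[k] TreeSpace k := bilin k (mulTree k)

/-- The tree `S / T`, with `S` grafted on the leftmost leaf of `T`. -/
def overTree (S : PTree) : PTree → PTree
  | .nil => S
  | .node _ c d => overTree S c △ d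

/-- The tree `S \ T`, with `T` grafted on the rightmost leaf of `S`. -/
def underTree (T : PTree) : PTree → PTree
  | .nil => T
  | .node _ a b => a △ underTree T b

/-- The bilinear extension of `S / T`. -/
def graftOver : TreeSpace k →ₗ[k] TreeSpace k →ₗ[k] TreeSpace k :=
  bilin k fun S T => tr (overTree S T)

/-- The bilinear extension of `S \ T`. -/
def graftUnder : TreeSpace k →ₗ[k] TreeSpace k →ₗ[k] TreeSpace k :=
  bilin k fun S T => tr (underTree T S)

end Operations

local notation:70 x:70 " ⋆ " y:71 => mul x y
local notation:70 x:71 " ⋎ " y:71 => graft _ x y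
local notation:70 x:70 " ⊘ " y:71 => graftOver x y
local notation "𝟙" => tr BinaryTree.nil
local notation "𝕐" => tr (BinaryTree.nil △ BinaryTree.nil)

/-! ### Algebraic identities between grafting, `*`, `/` and `\`. -/

section Algebra

variable {k : Type*} [Field k]

@[elab_as_elim]
theorem treeSpace_induction {P : TreeSpace k → Prop} (x : TreeSpace k) (zero : P 0)
    (add : ∀ x y, P x → P y → P (x + y)) (smul : ∀ (c : k) x, P x → P (c • x))
    (tree : ∀ T, P (tr T)) : P x := by
  induction x using Finsupp.induction_linear with
  | zero => exact zero
  | add x y hx hy => exact add x y hx hy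
  | single T c => simpa using smul c _ (tree T)

@[elab_as_elim]
theorem Dend_induction {n : ℕ} {P : (x : TreeSpace k) → x ∈ Dend k n → Prop}
    (zero : P 0 (Submodule.zero_mem _))
    (add : ∀ x y hx hy, P x hx → P y hy → P (x + y) (Submodule.add_mem _ hx hy))
    (smul : ∀ (c : k) x hx, P x hx → P (c • x) (Submodule.smul_mem _ c hx))
    (tree : ∀ T (hT : T.numNodes = n), P (tr T) (single_mem_Dend hT))
    (x : TreeSpace k) (hx : x ∈ Dend k n) : P x hx := by
  have key : ∀ y (_ : y ∈ Submodule.span k ((fun T => (tr T : TreeSpace k)) ''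
      {T : PTree | T.numNodes = n})), ∃ hy : y ∈ Dend k n, P y hy := by
    intro y hy
    induction hy using Submodule.span_induction with
    | mem x h => obtain ⟨T, hT, rfl⟩ := h; exact ⟨_, tree T hT⟩
    | zero => exact ⟨_, zero⟩
    | add x y _ _ hx hy => exact ⟨_, add x y _ _ hx.2 hy.2⟩
    | smul c x _ hx => exact ⟨_, smul c x _ hx.2⟩
  have h := hx
  rw [Dend, Finsupp.supported_eq_span_single] at h
  exact (key x h).2

@[simp] theorem bilin_tr (f : PTree → PTree → TreeSpace k) (S T : PTree) :
    bilin k f (tr S) (tr T) = f S T := by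
  simp [bilin]

theorem tr_node (u : Unit) (S T : PTree) :
    (tr (.node u S T) : TreeSpace k) = tr S ⋎ tr T :=
  (bilin_tr (fun S T => tr (S △ T)) S T).symm

@[simp] theorem graft_tr (S T : PTree) : (tr S : TreeSpace k) ⋎ tr T = tr (S △ T) := bilin_tr _ _ _

theorem mul_tr (S T : PTree) : (tr S : TreeSpace k) ⋆ tr T = mulTree k S T := bilin_tr _ _ _

@[simp] theorem over_tr (S T : PTree) : (tr S : TreeSpace k) ⊘ tr T = tr (overTree S T) :=
  bilin_tr _ _ _

@[simp] theorem under_tr (S T : PTree) :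
    graftUnder (tr S : TreeSpace k) (tr T) = tr (underTree T S) :=
  bilin_tr _ _ _

theorem mul_mem {n m p : ℕ} (hp : n + m = p) {x y : TreeSpace k}
    (hx : x ∈ Dend k n) (hy : y ∈ Dend k m) : x ⋆ y ∈ Dend k p :=
  bilin_mem (fun S T hS hT => hp ▸ hS ▸ hT ▸ mulTree_mem S T) hx hy

theorem numNodes_overTree (S T : PTree) :
    (overTree S T).numNodes = S.numNodes + T.numNodes := by
  induction T with
  | nil => rfl
  | node _ c d ih _ => simp only [overTree, BinaryTree.numNodes, ih]; omega

theorem over_mem {n m p : ℕ} (hp : n + m = p) {x y : TreeSpace k}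
    (hx : x ∈ Dend k n) (hy : y ∈ Dend k m) : x ⊘ y ∈ Dend k p :=
  bilin_mem (fun S T hS hT => single_mem_Dend (by rw [numNodes_overTree]; omega)) hx hy

@[simp] theorem one_mul (x : TreeSpace k) : 𝟙 ⋆ x = x := by
  induction x using treeSpace_induction with
  | zero => simp
  | add x y hx hy => rw [map_add, hx, hy]
  | smul c x hx => rw [map_smul, hx]
  | tree T => rw [mul_tr, mulTree]

@[simp] theorem mul_one (x : TreeSpace k) : x ⋆ 𝟙 = x := by
  induction x using treeSpace_induction with
  | zero => simp
  | add x y hx hy => rw [map_add, LinearMap.add_apply, hx, hy]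
  | smul c x hx => rw [map_smul, LinearMap.smul_apply, hx]
  | tree T => cases T <;> rw [mul_tr, mulTree]

@[simp] theorem over_one (x : TreeSpace k) : x ⊘ 𝟙 = x := by
  induction x using treeSpace_induction with
  | zero => simp
  | add x y hx hy => rw [map_add, LinearMap.add_apply, hx, hy]
  | smul c x hx => rw [map_smul, LinearMap.smul_apply, hx]
  | tree T => rw [over_tr, overTree]

@[simp] theorem one_under (x : TreeSpace k) : graftUnder 𝟙 x = x := by
  induction x using treeSpace_induction with
  | zero => simp
  | add x y hx hy => rw [map_add, hx, hy]
  | smul c x hx => rw [map_smul, hx]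
  | tree T => rw [under_tr, underTree]

theorem over_graft (x c d : TreeSpace k) : x ⊘ (c ⋎ d) = (x ⊘ c) ⋎ d := by
  induction x using treeSpace_induction with
  | zero => simp
  | add x y hx hy => simp only [map_add, LinearMap.add_apply, hx, hy]
  | smul s x hx => simp only [map_smul, LinearMap.smul_apply, hx]
  | tree T =>
    induction c using treeSpace_induction with
    | zero => simp
    | add x y hx hy => simp only [map_add, LinearMap.add_apply, hx, hy]
    | smul s x hx => simp only [map_smul, LinearMap.smul_apply, hx]
    | tree C =>
      induction d using treeSpace_induction with
      | zero => simp
      | add x y hx hy => simp only [map_add, hx, hy]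
      | smul s x hx => simp only [map_smul, hx]
      | tree D => simp [overTree]

theorem under_graft (a b y : TreeSpace k) : graftUnder (a ⋎ b) y = a ⋎ (graftUnder b y) := by
  induction a using treeSpace_induction with
  | zero => simp
  | add x y hx hy => simp only [map_add, LinearMap.add_apply, hx, hy]
  | smul s x hx => simp only [map_smul, LinearMap.smul_apply, hx]
  | tree A =>
    induction b using treeSpace_induction with
    | zero => simp
    | add x y hx hy => simp only [map_add, LinearMap.add_apply, hx, hy]
    | smul s x hx => simp only [map_smul, LinearMap.smul_apply, hx]
    | tree B =>
      induction y using treeSpace_induction with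
      | zero => simp
      | add x y hx hy => simp only [map_add, hx, hy]
      | smul s x hx => simp only [map_smul, hx]
      | tree D => simp [underTree]

theorem graft_mul_graft (a b c d : TreeSpace k) :
    (a ⋎ b) ⋆ (c ⋎ d) = ((a ⋎ b) ⋆ c) ⋎ d + a ⋎ (b ⋆ (c ⋎ d)) := by
  induction a using treeSpace_induction with
  | zero => simp
  | add x y hx hy => simp only [map_add, LinearMap.add_apply, hx, hy]; abel
  | smul s x hx => simp only [map_smul, LinearMap.smul_apply, hx, smul_add]
  | tree A =>
  induction b using treeSpace_induction with
  | zero => simp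
  | add x y hx hy => simp only [map_add, LinearMap.add_apply, hx, hy]; abel
  | smul s x hx => simp only [map_smul, LinearMap.smul_apply, hx, smul_add]
  | tree B =>
  induction c using treeSpace_induction with
  | zero => simp
  | add x y hx hy => simp only [map_add, LinearMap.add_apply, hx, hy]; abel
  | smul s x hx => simp only [map_smul, LinearMap.smul_apply, hx, smul_add]
  | tree C =>
  induction d using treeSpace_induction with
  | zero => simp
  | add x y hx hy => simp only [map_add, hx, hy]; abel
  | smul s x hx => simp only [map_smul, hx, smul_add]
  | tree D => simp only [graft_tr, mul_tr]; rw [mulTree]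

/-- The recursion for `*` shortens either factor, so the induction runs on a bound for the total
degree rather than on one of the trees. -/
theorem mul_assoc_tr (n : ℕ) : ∀ p q r : PTree, p.numNodes + q.numNodes + r.numNodes ≤ n →
    ((tr p : TreeSpace k) ⋆ tr q) ⋆ tr r = tr p ⋆ (tr q ⋆ tr r) := by
  induction n with
  | zero =>
    rintro (_ | ⟨_, a, b⟩) (_ | ⟨_, c, d⟩) (_ | ⟨_, e, f⟩) h
    · simp
    all_goals simp only [BinaryTree.numNodes] at h; omega
  | succ n ih =>
    rintro (_ | ⟨_, a, b⟩) (_ | ⟨_, c, d⟩) (_ | ⟨_, e, f⟩) h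
    -- The eighth case is the one where no factor is `|`; expanding both sides leaves three matching
    -- terms, two of which need the induction hypothesis.
    on_goal 8 =>
      have h1 := ih (a △ b) (c △ d) e (by simp only [BinaryTree.numNodes] at h ⊢; omega)
      have h2 := ih b (c △ d) (e △ f) (by simp only [BinaryTree.numNodes] at h ⊢; omega)
      simp only [tr_node] at h1 h2 ⊢
      rw [graft_mul_graft (tr a) (tr b) (tr c) (tr d)] at h1 ⊢
      rw [graft_mul_graft (tr c) (tr d) (tr e) (tr f)] at h2 ⊢
      simp only [map_add, LinearMap.add_apply, graft_mul_graft] at h1 h2 ⊢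
      rw [← h1, h2]
      simp only [map_add, LinearMap.add_apply]
      abel
    all_goals simp

theorem mul_assoc (x y z : TreeSpace k) : (x ⋆ y) ⋆ z = x ⋆ (y ⋆ z) := by
  induction x using treeSpace_induction with
  | zero => simp
  | add x y hx hy => simp only [map_add, LinearMap.add_apply, hx, hy]
  | smul s x hx => simp only [map_smul, LinearMap.smul_apply, hx]
  | tree A =>
  induction y using treeSpace_induction with
  | zero => simp
  | add x y hx hy => simp only [map_add, LinearMap.add_apply, hx, hy]
  | smul s x hx => simp only [map_smul, LinearMap.smul_apply, hx]
  | tree B =>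
  induction z using treeSpace_induction with
  | zero => simp
  | add x y hx hy => simp only [map_add, hx, hy]
  | smul s x hx => simp only [map_smul, hx]
  | tree C => exact mul_assoc_tr _ A B C le_rfl

theorem over_assoc (x y z : TreeSpace k) : (x ⊘ y) ⊘ z = x ⊘ (y ⊘ z) := by
  induction z using treeSpace_induction with
  | zero => simp
  | add x y hx hy => simp only [map_add, hx, hy]
  | smul s x hx => simp only [map_smul, hx]
  | tree C =>
  induction C with
  | nil => simp
  | node _ c d ih _ => simp only [tr_node, over_graft, ih]

/-- A factor on the left leaf can be pulled out of a product. -/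
theorem over_mul_graft (x a b z : TreeSpace k) : x ⊘ ((a ⋎ b) ⋆ z) = ((x ⊘ a) ⋎ b) ⋆ z := by
  induction z using treeSpace_induction with
  | zero => simp
  | add x y hx hy => simp only [map_add, hx, hy]
  | smul s x hx => simp only [map_smul, hx]
  | tree C =>
  induction C with
  | nil => simp [over_graft]
  | node _ c d ih _ => simp only [tr_node, graft_mul_graft, map_add, over_graft, ih]

/-- Mirror image of `over_mul_graft`: multiplication on the left by `x` never touches the rightmost
leaf of a nonempty right factor. -/
theorem under_mul_graft (x c d z : TreeSpace k) :
    graftUnder (x ⋆ (c ⋎ d)) z = x ⋆ (c ⋎ (graftUnder d z)) := by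
  induction x using treeSpace_induction with
  | zero => simp
  | add x y hx hy => simp only [map_add, LinearMap.add_apply, hx, hy]
  | smul s x hx => simp only [map_smul, LinearMap.smul_apply, hx]
  | tree A =>
  induction A with
  | nil => simp [under_graft]
  | node _ a b _ ih =>
    simp only [tr_node, graft_mul_graft, map_add, LinearMap.add_apply, under_graft, ih]

/-- Elements of positive degree are combinations of grafts. -/
@[elab_as_elim]
theorem Dend_succ_induction {n : ℕ} {P : (x : TreeSpace k) → x ∈ Dend k (n + 1) → Prop}
    (zero : P 0 (Submodule.zero_mem _))
    (add : ∀ x y hx hy, P x hx → P y hy → P (x + y) (Submodule.add_mem _ hx hy))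
    (smul : ∀ (c : k) x hx, P x hx → P (c • x) (Submodule.smul_mem _ c hx))
    (graft : ∀ (a b : PTree) (h : graft k (tr a) (tr b) ∈ Dend k (n + 1)),
      a.numNodes + b.numNodes = n → P (graft k (tr a) (tr b)) h)
    (x : TreeSpace k) (hx : x ∈ Dend k (n + 1)) : P x hx := by
  induction x, hx using Dend_induction with
  | zero => exact zero
  | add x y _ _ hx hy => exact add x y _ _ hx hy
  | smul c x _ hx => exact smul c x _ hx
  | tree T hT =>
    rcases T with _ | ⟨_, a, b⟩
    · simp at hT
    · have h := graft a b (graft_mem (by simpa [BinaryTree.numNodes] using hT)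
        (single_mem_Dend rfl) (single_mem_Dend rfl)) (by simpa [BinaryTree.numNodes] using hT)
      simpa only [tr_node] using h

end Algebra

/-! ### Partial compositions and their compatibility with the products. -/

section Composition

variable {k : Type*} [Field k]

theorem one_mem : (𝟙 : TreeSpace k) ∈ Dend k 0 := single_mem_Dend rfl

theorem unit_mem : (𝕐 : TreeSpace k) ∈ Dend k 1 := single_mem_Dend rfl

theorem tr_mem (T : PTree) : (tr T : TreeSpace k) ∈ Dend k T.numNodes := single_mem_Dend rfl

@[simp] theorem compTotal_tr (i : ℕ) (T : PTree) (x : TreeSpace k) :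
    compTotal k i (tr T) x = compTree k T i x := by
  simp [compTotal]

theorem compTotal_one (i : ℕ) (x : TreeSpace k) : compTotal k i 𝟙 x = 0 := by
  rw [compTotal_tr, compTree_nil_apply]

theorem compTotal_graft_left {n j : ℕ} (hj : j ≤ n) {u : TreeSpace k} (hu : u ∈ Dend k n)
    (v x : TreeSpace k) : compTotal k j (u ⋎ v) x = compTotal k j u x ⋎ v := by
  induction u, hu using Dend_induction with
  | zero => simp
  | add _ _ _ _ hx hy => simp only [map_add, LinearMap.add_apply, hx, hy]
  | smul s x _ hx => simp only [map_smul, LinearMap.smul_apply, hx]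
  | tree U hU =>
    induction v using treeSpace_induction with
    | zero => simp
    | add x y hx hy => simp only [map_add, LinearMap.add_apply, hx, hy]
    | smul s x hx => simp only [map_smul, LinearMap.smul_apply, hx]
    | tree V =>
      rw [graft_tr, compTotal_tr, compTotal_tr, compTree_node_apply, if_pos (by omega)]

theorem compTotal_graft_right {n i j : ℕ} (hj : j = n + 1 + i) (hi : 1 ≤ i) {u : TreeSpace k}
    (hu : u ∈ Dend k n) (v x : TreeSpace k) :
    compTotal k j (u ⋎ v) x = u ⋎ compTotal k i v x := by
  induction u, hu using Dend_induction with
  | zero => simp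
  | add _ _ _ _ hx hy => simp only [map_add, LinearMap.add_apply, hx, hy]
  | smul s x _ hx => simp only [map_smul, LinearMap.smul_apply, hx]
  | tree U hU =>
    induction v using treeSpace_induction with
    | zero => simp
    | add x y hx hy => simp only [map_add, LinearMap.add_apply, hx, hy]
    | smul s x hx => simp only [map_smul, LinearMap.smul_apply, hx]
    | tree V =>
      rw [graft_tr, compTotal_tr, compTotal_tr, compTree_node_apply, if_neg (by omega),
        if_neg (by omega)]
      congr 3
      omega

/-- Insertion at the root is `u ≻ (c △ d) ≺ v`: the operation `≻` multiplies `u` into the left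
subtree and `≺` multiplies `v` into the right one. -/
theorem compTotal_graft_root {n j : ℕ} (hj : j = n + 1) {u : TreeSpace k} (hu : u ∈ Dend k n)
    (v c d : TreeSpace k) : compTotal k j (u ⋎ v) (c ⋎ d) = (u ⋆ c) ⋎ (d ⋆ v) := by
  induction u, hu using Dend_induction with
  | zero => simp
  | add _ _ _ _ hx hy => simp only [map_add, LinearMap.add_apply, hx, hy]
  | smul s x _ hx => simp only [map_smul, LinearMap.smul_apply, hx]
  | tree U hU =>
  induction v using treeSpace_induction with
  | zero => simp
  | add x y hx hy => simp only [map_add, LinearMap.add_apply, hx, hy]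
  | smul s x hx => simp only [map_smul, LinearMap.smul_apply, hx]
  | tree V =>
  induction d using treeSpace_induction with
  | zero => simp
  | add x y hx hy => simp only [map_add, LinearMap.add_apply, hx, hy]
  | smul s x hx => simp only [map_smul, LinearMap.smul_apply, hx]
  | tree D =>
  induction c using treeSpace_induction with
  | zero => simp
  | add x y hx hy => simp only [map_add, LinearMap.add_apply, hx, hy]
  | smul s x hx => simp only [map_smul, LinearMap.smul_apply, hx]
  | tree C =>
    rw [graft_tr U V, graft_tr C D, compTotal_tr, compTree_node_apply, if_neg (by omega),
      if_pos (by omega), succ, bilin_tr, succTree, ← mul_tr]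
    generalize (tr U ⋆ tr C : TreeSpace k) = w
    induction w using treeSpace_induction with
    | zero => simp
    | add x y hx hy => simp only [map_add, LinearMap.add_apply, hx, hy]
    | smul s x hx => simp only [map_smul, LinearMap.smul_apply, hx]
    | tree W => rw [graft_tr, prec, bilin_tr, precTree, mul_tr]

theorem unit_eq : (𝕐 : TreeSpace k) = 𝟙 ⋎ 𝟙 := (graft_tr _ _).symm

theorem unit_compTotal {m : ℕ} {x : TreeSpace k} (hx : x ∈ Dend k (m + 1)) :
    compTotal k 1 𝕐 x = x := by
  induction x, hx using Dend_succ_induction with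
  | zero => simp
  | add _ _ _ _ hx hy => simp only [map_add, hx, hy]
  | smul s x _ hx => simp only [map_smul, hx]
  | graft e f _ _ => rw [unit_eq, compTotal_graft_root rfl one_mem, one_mul, mul_one]

theorem unit_mul_graft (c d : TreeSpace k) : 𝕐 ⋆ (c ⋎ d) = (𝕐 ⋆ c) ⋎ d + 𝟙 ⋎ (c ⋎ d) := by
  rw [unit_eq, graft_mul_graft, one_mul]

/-- Insertion into the second factor of `Y * a`. -/
theorem compTotal_unit_mul {m i : ℕ} (hi : 1 ≤ i) (a : TreeSpace k) {x : TreeSpace k}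
    (hx : x ∈ Dend k (m + 1)) : compTotal k (i + 1) (𝕐 ⋆ a) x = 𝕐 ⋆ compTotal k i a x := by
  induction a using treeSpace_induction with
  | zero => simp
  | add x y hx hy => simp only [map_add, LinearMap.add_apply, hx, hy]
  | smul s x hx => simp only [map_smul, LinearMap.smul_apply, hx]
  | tree A =>
  induction x, hx using Dend_succ_induction with
  | zero => simp
  | add _ _ _ _ hx hy => simp only [map_add, hx, hy]
  | smul s x _ hx => simp only [map_smul, hx]
  | graft e f _ _ =>
  induction A generalizing i with
  | nil =>
    rw [mul_one, compTotal_one, unit_eq,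
      compTotal_graft_right (n := 0) (i := i) (by omega) hi one_mem, compTotal_one, map_zero,
      map_zero]
  | node _ c d ihc ihd =>
    have hY : (𝕐 ⋆ tr c : TreeSpace k) ∈ Dend k (c.numNodes + 1) :=
      mul_mem (by omega) unit_mem (tr_mem c)
    rw [tr_node _ c d, unit_mul_graft, map_add, LinearMap.add_apply,
      compTotal_graft_right (n := 0) (i := i) (by omega) hi one_mem]
    -- Vertex `i` lies left of the root of `c △ d`, is that root, or lies right of it. The factor
    -- `Y` shifts the numbering of the first summand by one.
    rcases lt_trichotomy i (c.numNodes + 1) with h | h | h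
    · rw [compTotal_graft_left (by omega) hY, compTotal_graft_left (by omega) (tr_mem c),
        unit_mul_graft, ihc hi]
    · rw [compTotal_graft_root (by omega) hY, compTotal_graft_root h (tr_mem c),
        unit_mul_graft, mul_assoc]
    · obtain ⟨j, rfl⟩ := Nat.exists_eq_add_of_lt h
      rw [compTotal_graft_right (i := j + 1) (by omega) (by omega) hY,
        compTotal_graft_right (i := j + 1) (by omega) (by omega) (tr_mem c), unit_mul_graft]

/-- The tree case of `compTotal_mul`. The bound `N` serves an induction on total degree, since the
product recursion shortens either factor. -/
theorem compTotal_mul_tr {j : ℕ} (e f : TreeSpace k) (N : ℕ) : ∀ p q : PTree,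
    p.numNodes + q.numNodes ≤ N → j ≤ p.numNodes →
    compTotal k j ((tr p : TreeSpace k) ⋆ tr q) (e ⋎ f) = compTotal k j (tr p) (e ⋎ f) ⋆ tr q := by
  induction N generalizing j with
  | zero =>
    rintro (_ | ⟨_, a, b⟩) q h hj
    · rw [one_mul, compTotal_one, map_zero, LinearMap.zero_apply]
      obtain rfl : q = .nil := by
        cases q
        · rfl
        · simp [BinaryTree.numNodes] at h
      rw [compTotal_one]
    · simp [BinaryTree.numNodes] at h
  | succ N ih =>
    rintro (_ | ⟨_, a, b⟩) q h hj
    · obtain rfl : j = 0 := by simpa [BinaryTree.numNodes] using hj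
      rw [one_mul, compTotal_one, map_zero, LinearMap.zero_apply, compTotal_tr]
      clear h
      induction q with
      | nil => exact compTree_nil_apply _ _
      | node _ c d ihc _ =>
        rw [compTree_node_apply, if_pos (by omega), ihc, map_zero, LinearMap.zero_apply]
    · rcases q with _ | ⟨_, c, d⟩
      · rw [mul_one, mul_one]
      simp only [BinaryTree.numNodes] at h hj
      have hpc : ((tr a ⋎ tr b) ⋆ tr c : TreeSpace k) ∈
          Dend k (a.numNodes + b.numNodes + 1 + c.numNodes) :=
        mul_mem rfl (graft_mem rfl (tr_mem a) (tr_mem b)) (tr_mem c)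
      have h1 := ih (j := j) (a △ b) c (by simp only [BinaryTree.numNodes]; omega)
        (by simp only [BinaryTree.numNodes]; omega)
      simp only [tr_node] at h1 ⊢
      rw [graft_mul_graft, map_add, LinearMap.add_apply, compTotal_graft_left (by omega) hpc, h1]
      rcases lt_trichotomy j (a.numNodes + 1) with h | h | h
      · rw [compTotal_graft_left (by omega) (tr_mem a), compTotal_graft_left (by omega) (tr_mem a),
          graft_mul_graft]
      · rw [compTotal_graft_root h (tr_mem a), compTotal_graft_root h (tr_mem a),
          graft_mul_graft, mul_assoc]
      · obtain ⟨i, rfl⟩ := Nat.exists_eq_add_of_lt h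
        rw [compTotal_graft_right (i := i + 1) (by omega) (by omega) (tr_mem a),
          compTotal_graft_right (i := i + 1) (by omega) (by omega) (tr_mem a), graft_mul_graft]
        have h2 := ih (j := i + 1) b (c △ d) (by simp only [BinaryTree.numNodes]; omega) (by omega)
        rw [tr_node] at h2
        rw [h2]

/-- Insertion into the first factor of a product. -/
theorem compTotal_mul {m n j : ℕ} (hj : j ≤ n) {p : TreeSpace k} (hp : p ∈ Dend k n)
    (q : TreeSpace k) {x : TreeSpace k} (hx : x ∈ Dend k (m + 1)) :
    compTotal k j (p ⋆ q) x = compTotal k j p x ⋆ q := by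
  induction p, hp using Dend_induction with
  | zero => simp
  | add _ _ _ _ hx hy => simp only [map_add, LinearMap.add_apply, hx, hy]
  | smul s x _ hx => simp only [map_smul, LinearMap.smul_apply, hx]
  | tree P hP =>
  induction q using treeSpace_induction with
  | zero => simp
  | add x y hx hy => simp only [map_add, LinearMap.add_apply, hx, hy]
  | smul s x hx => simp only [map_smul, LinearMap.smul_apply, hx]
  | tree Q =>
  induction x, hx using Dend_succ_induction with
  | zero => simp
  | add _ _ _ _ hx hy => simp only [map_add, LinearMap.add_apply, hx, hy]
  | smul s x _ hx => simp only [map_smul, LinearMap.smul_apply, hx]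
  | graft e f _ _ => exact compTotal_mul_tr _ _ _ P Q le_rfl (by omega)

/-- Insertion into the upper part of `p / q`. -/
theorem compTotal_over {n j : ℕ} (hj : j ≤ n) {p : TreeSpace k} (hp : p ∈ Dend k n)
    (q x : TreeSpace k) : compTotal k j (p ⊘ q) x = compTotal k j p x ⊘ q := by
  induction q using treeSpace_induction with
  | zero => simp
  | add x y hx hy => simp only [map_add, LinearMap.add_apply, hx, hy]
  | smul s x hx => simp only [map_smul, LinearMap.smul_apply, hx]
  | tree Q =>
  induction Q with
  | nil => rw [over_one, over_one]
  | node _ c d ih _ =>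
    rw [tr_node, over_graft, over_graft, ← ih,
      compTotal_graft_left (by omega) (over_mem rfl hp (tr_mem c))]

/-- Insertion into the lower part of `p / q`, at a place that is not the first one. -/
theorem compTotal_over_right {l m n i j : ℕ} (hi : i = n + j) (hj : 2 ≤ j) {p : TreeSpace k}
    (hp : p ∈ Dend k n) {q : TreeSpace k} (hq : q ∈ Dend k (l + 1)) {x : TreeSpace k}
    (hx : x ∈ Dend k (m + 1)) :
    compTotal k i (p ⊘ q) x = p ⊘ compTotal k j q x := by
  subst hi
  induction x, hx using Dend_succ_induction with
  | zero => simp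
  | add _ _ _ _ hx hy => simp only [map_add, hx, hy]
  | smul s x _ hx => simp only [map_smul, hx]
  | graft e f _ _ =>
  induction q, hq using Dend_induction with
  | zero => simp
  | add _ _ _ _ hx hy => simp only [map_add, LinearMap.add_apply, hx, hy]
  | smul s x _ hx => simp only [map_smul, LinearMap.smul_apply, hx]
  | tree Q hQ =>
  induction Q generalizing l with
  | nil => simp at hQ
  | node _ c d ih _ =>
  rw [tr_node, over_graft]
  -- If `c = |`, the root is the first vertex, so the place `j ≥ 2` lies in `d`. Otherwise `c` has
  -- positive degree and the induction hypothesis applies to it.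
  rcases c with _ | ⟨_, c₁, c₂⟩
  · rw [over_one, compTotal_graft_right (i := j - 1) (by omega) (by omega) hp,
      compTotal_graft_right (i := j - 1) (n := 0) (by omega) (by omega) one_mem, over_graft,
      over_one]
  have ih := ih (l := c₁.numNodes + c₂.numNodes) rfl
  -- The equation `hc` is kept because insertion at the root needs `over_mul_graft`, where the left
  -- factor must be a graft.
  generalize hc : c₁ △ c₂ = c at *
  have hpc : p ⊘ tr c ∈ Dend k (n + c.numNodes) := over_mem rfl hp (tr_mem c)
  rcases lt_trichotomy j (c.numNodes + 1) with h | h | h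
  · rw [compTotal_graft_left (by omega) hpc, compTotal_graft_left (by omega) (tr_mem c), ih,
      over_graft]
  · rw [compTotal_graft_root (by omega) hpc, compTotal_graft_root h (tr_mem c), over_graft,
      ← hc, tr_node, over_mul_graft, over_graft]
  · obtain ⟨i, rfl⟩ := Nat.exists_eq_add_of_lt h
    rw [compTotal_graft_right (i := i + 1) (by omega) (by omega) hpc,
      compTotal_graft_right (i := i + 1) (by omega) (by omega) (tr_mem c), over_graft]

/-- The first vertex of `q` has `|` as its left subtree, so nothing is multiplied into the left part
of the inserted element and its leftmost leaf stays free for `p`. -/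
theorem compTotal_one_over {l m : ℕ} (p : TreeSpace k) {q : TreeSpace k}
    (hq : q ∈ Dend k (l + 1)) {z : TreeSpace k} (hz : z ∈ Dend k (m + 1)) :
    compTotal k 1 q (p ⊘ z) = p ⊘ compTotal k 1 q z := by
  induction z, hz using Dend_succ_induction with
  | zero => simp
  | add _ _ _ _ hx hy => simp only [map_add, hx, hy]
  | smul s x _ hx => simp only [map_smul, hx]
  | graft e f _ _ =>
  induction q, hq using Dend_induction with
  | zero => simp
  | add _ _ _ _ hx hy => simp only [map_add, LinearMap.add_apply, hx, hy]
  | smul s x _ hx => simp only [map_smul, LinearMap.smul_apply, hx]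
  | tree Q hQ =>
  induction Q generalizing l with
  | nil => simp at hQ
  | node _ c d ih _ =>
  rw [tr_node, over_graft]
  rcases c with _ | ⟨_, c₁, c₂⟩
  · rw [compTotal_graft_root rfl one_mem, compTotal_graft_root rfl one_mem, over_graft, one_mul,
      one_mul]
  · have ih := ih (l := c₁.numNodes + c₂.numNodes) rfl
    rw [over_graft] at ih
    rw [compTotal_graft_left (by simp [BinaryTree.numNodes]) (tr_mem _),
      compTotal_graft_left (by simp [BinaryTree.numNodes]) (tr_mem _), ih, over_graft]

end Composition

/-! ### The anticyclic map: recursive definition and composition axioms. -/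

section Tau

variable {k : Type*} [Field k]

theorem compTotal_one_unit {l : ℕ} {q : TreeSpace k} (hq : q ∈ Dend k (l + 1)) :
    compTotal k 1 q 𝕐 = q := by
  induction q, hq using Dend_induction with
  | zero => simp
  | add _ _ _ _ hx hy => simp only [map_add, LinearMap.add_apply, hx, hy]
  | smul s x _ hx => simp only [map_smul, LinearMap.smul_apply, hx]
  | tree Q hQ =>
  induction Q generalizing l with
  | nil => simp at hQ
  | node _ c d ih _ =>
  rw [tr_node]
  rcases c with _ | ⟨_, c₁, c₂⟩
  · rw [unit_eq, compTotal_graft_root rfl one_mem, mul_one, one_mul]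
  · rw [compTotal_graft_left (by simp [BinaryTree.numNodes]) (tr_mem _),
      ih (l := c₁.numNodes + c₂.numNodes) rfl]

/-- The values on trees of the anticyclic structure map. -/
def tauTree : PTree → TreeSpace k
  | .nil => 𝟙
  | .node _ a b => -((𝕐 ⋆ tr a) ⊘ tauTree b)

/-- The anticyclic structure map, on the space of all trees. -/
def tau : TreeSpace k →ₗ[k] TreeSpace k := Finsupp.linearCombination k tauTree

theorem tau_tr (T : PTree) : tau (tr T : TreeSpace k) = tauTree T := by
  simp [tau]

@[simp] theorem tau_one : tau (𝟙 : TreeSpace k) = 𝟙 := by rw [tau_tr, tauTree]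

theorem tau_graft (a b : TreeSpace k) : tau (a ⋎ b) = -((𝕐 ⋆ a) ⊘ tau b) := by
  induction a using treeSpace_induction with
  | zero => simp
  | add x y hx hy => simp only [map_add, LinearMap.add_apply, hx, hy, neg_add]
  | smul s x hx => simp only [map_smul, LinearMap.smul_apply, hx, smul_neg]
  | tree A =>
    induction b using treeSpace_induction with
    | zero => simp
    | add x y hx hy => simp only [map_add, hx, hy, neg_add]
    | smul s x hx => simp only [map_smul, hx, smul_neg]
    | tree B => rw [graft_tr, tau_tr, tau_tr, tauTree]

theorem tau_mem {n : ℕ} {x : TreeSpace k} (hx : x ∈ Dend k n) : tau x ∈ Dend k n := by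
  refine linearCombination_mem (fun T hT => ?_) hx
  subst hT
  clear hx
  induction T with
  | nil => exact one_mem
  | node _ a b _ ih =>
    exact Submodule.neg_mem _ (over_mem (by simp only [BinaryTree.numNodes]; omega)
      (mul_mem rfl unit_mem (tr_mem a)) ih)

/-- This gives `tau` on the upper interval sums, which have the form `x * (| △ y)`. In the induction
on `x`, the two terms of the product recursion recombine through `Y * (a △ b) = (Y * a) △ b + | △ (a
△ b)`. -/
theorem tau_mul_graft (x c d : TreeSpace k) :
    tau (x ⋆ (c ⋎ d)) = -(((𝟙 ⋎ x) ⋆ c) ⊘ tau d) := by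
  induction x using treeSpace_induction with
  | zero => simp
  | add x y hx hy => simp only [map_add, LinearMap.add_apply, hx, hy, neg_add]
  | smul s x hx => simp only [map_smul, LinearMap.smul_apply, hx, smul_neg]
  | tree X =>
  induction X with
  | nil => rw [one_mul, tau_graft, unit_eq]
  | node _ a b _ ih =>
    rw [tr_node _ a b, graft_mul_graft, map_add, tau_graft, tau_graft, ih, map_neg, neg_neg,
      ← over_assoc, over_mul_graft, over_one, ← mul_assoc, unit_mul_graft]
    simp only [map_add, LinearMap.add_apply]
    abel

/-- In `(Y * a) / tau b` the vertices are those of `T` shifted by one: those of `a` stay in the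
upper part, those of `b` in the lower part. Only insertion at the root of `T` mixes the two, and
there `tau_mul_graft` is needed. -/
theorem tau_compTotal_tr {m : ℕ} {x : TreeSpace k} (hx : x ∈ Dend k (m + 1)) (T : PTree) :
    ∀ i, 1 ≤ i → i < T.numNodes →
      tau (compTotal k i (tr T) x) = compTotal k (i + 1) (tau (tr T)) x := by
  induction T with
  | nil => intro i _ h; simp at h
  | node _ a b iha ihb =>
  clear iha
  intro i hi h
  simp only [BinaryTree.numNodes] at h
  have hY : (𝕐 ⋆ tr a : TreeSpace k) ∈ Dend k (a.numNodes + 1) :=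
    mul_mem (by omega) unit_mem (tr_mem a)
  rw [tr_node, tau_graft, map_neg, LinearMap.neg_apply]
  rcases lt_trichotomy i (a.numNodes + 1) with h1 | h1 | h1
  · rw [compTotal_graft_left (by omega) (tr_mem a), tau_graft, compTotal_over (by omega) hY,
      compTotal_unit_mul hi _ hx]
  -- If `b = |`, the root is the last vertex of `T`, which `i < T.numNodes` excludes.
  · rcases b with _ | ⟨_, c, d⟩
    · simp at h; omega
    clear ihb
    induction x, hx using Dend_succ_induction with
    | zero => simp
    | add _ _ _ _ hx hy => simp only [map_add, hx, hy, neg_add]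
    | smul s x _ hx => simp only [map_smul, hx, smul_neg]
    | graft e f hx' _ =>
    have h2 : ((𝕐 ⋆ tr a) ⋎ 𝟙 : TreeSpace k) ∈ Dend k (a.numNodes + 2) :=
      graft_mem (by omega) hY one_mem
    rw [compTotal_graft_root h1 (tr_mem a), tr_node _ c d, tau_graft, tau_graft, tau_mul_graft,
      map_neg, map_neg, map_neg, LinearMap.neg_apply, neg_neg, neg_neg, ← over_assoc,
      over_mul_graft, over_one, ← over_assoc, unit_eq, over_mul_graft, over_one, ← unit_eq,
      compTotal_over (n := a.numNodes + 2 + c.numNodes) (by omega) (mul_mem rfl h2 (tr_mem c)),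
      compTotal_mul (by omega) h2 _ hx', compTotal_graft_root (by omega) hY, mul_one, mul_assoc]
  · obtain ⟨j, rfl⟩ := Nat.exists_eq_add_of_lt h1
    rcases b with _ | ⟨_, c, d⟩
    · simp at h; omega
    rw [compTotal_graft_right (i := j + 1) (by omega) (by omega) (tr_mem a), tau_graft,
      ihb _ (by omega) (by omega),
      compTotal_over_right (j := j + 1 + 1) (by omega) (by omega) hY
        (tau_mem (tr_mem (.node _ c d))) hx]

theorem tau_compTotal {m n i : ℕ} (hi : 1 ≤ i) (hin : i < n) {a x : TreeSpace k}
    (ha : a ∈ Dend k n) (hx : x ∈ Dend k (m + 1)) :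
    tau (compTotal k i a x) = compTotal k (i + 1) (tau a) x := by
  induction a, ha using Dend_induction with
  | zero => simp
  | add _ _ _ _ hx hy => simp only [map_add, LinearMap.add_apply, hx, hy]
  | smul s x _ hx => simp only [map_smul, LinearMap.smul_apply, hx]
  | tree T hT => exact tau_compTotal_tr hx T i hi (by omega)

/-- The last vertex lies in `b` unless `b = |`. The induction follows the right branch down to `a △
|`, whose last vertex is its root; there the product `Y * a * e` can be read as `Y * e` with `Y * a`
inserted at its first vertex. -/
theorem tau_compTotal_last_tr {m : ℕ} {x : TreeSpace k} (hx : x ∈ Dend k (m + 1)) (T : PTree) :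
    ∀ n, T.numNodes = n + 1 →
      tau (compTotal k (n + 1) (tr T) x) = -compTotal k 1 (tau x) (tau (tr T)) := by
  induction T with
  | nil => intro n h; simp at h
  | node _ a b iha ihb =>
  clear iha
  intro n h
  simp only [BinaryTree.numNodes] at h
  have hY : (𝕐 ⋆ tr a : TreeSpace k) ∈ Dend k (a.numNodes + 1) :=
    mul_mem (by omega) unit_mem (tr_mem a)
  rw [tr_node, tau_graft, map_neg, neg_neg]
  rcases b with _ | ⟨_, c, d⟩
  · simp only [BinaryTree.numNodes] at h
    clear ihb
    induction x, hx using Dend_succ_induction with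
    | zero => simp
    | add _ _ _ _ hx hy => simp only [map_add, LinearMap.add_apply, hx, hy]
    | smul s x _ hx => simp only [map_smul, LinearMap.smul_apply, hx]
    | graft e f _ _ =>
    rw [compTotal_graft_root (by omega) (tr_mem a), tau_one, over_one, mul_one, tau_graft,
      tau_graft, map_neg, LinearMap.neg_apply,
      compTotal_over (n := 1 + e.numNodes) (by omega) (mul_mem rfl unit_mem (tr_mem e)),
      compTotal_mul le_rfl unit_mem _ hY, unit_compTotal hY, mul_assoc]
  · have ih := ihb (c.numNodes + d.numNodes) rfl
    simp only [BinaryTree.numNodes] at h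
    rw [compTotal_graft_right (i := c.numNodes + d.numNodes + 1) (by omega) (by omega) (tr_mem a),
      tau_graft, ih, map_neg, neg_neg,
      compTotal_one_over _ (tau_mem hx) (tau_mem (tr_mem (.node _ c d)))]

theorem tau_compTotal_last {m n : ℕ} {a x : TreeSpace k}
    (ha : a ∈ Dend k (n + 1)) (hx : x ∈ Dend k (m + 1)) :
    tau (compTotal k (n + 1) a x) = -compTotal k 1 (tau x) (tau a) := by
  induction a, ha using Dend_induction with
  | zero => simp
  | add _ _ _ _ hx hy => simp only [map_add, LinearMap.add_apply, hx, hy, neg_add]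
  | smul s x _ hx => simp only [map_smul, LinearMap.smul_apply, hx, smul_neg]
  | tree T hT => exact tau_compTotal_last_tr hx T n hT

/-! ### The relation τ^(n+1) = Id. -/

theorem iterate_tau_mem {n : ℕ} {x : TreeSpace k} (hx : x ∈ Dend k n) (s : ℕ) :
    tau^[s] x ∈ Dend k n := by
  induction s with
  | zero => exact hx
  | succ s ih => rw [Function.iterate_succ_apply']; exact tau_mem ih

theorem iterate_tau_compTotal {m n i : ℕ} (hi : 1 ≤ i) {a x : TreeSpace k}
    (ha : a ∈ Dend k n) (hx : x ∈ Dend k (m + 1)) (s : ℕ) (hs : i + s ≤ n) :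
    tau^[s] (compTotal k i a x) = compTotal k (i + s) (tau^[s] a) x := by
  induction s with
  | zero => rfl
  | succ s ih =>
    rw [Function.iterate_succ_apply', Function.iterate_succ_apply', ih (by omega),
      tau_compTotal (n := n) (by omega) (by omega) (iterate_tau_mem ha s) hx, add_assoc]

/-- Rotating `a ∘_i b` all the way round moves `b` to the last place of `a`, exchanges the two,
moves `a` to the last place of `b`, exchanges them again and brings `b` back to place `i`. The two
signs cancel, and each factor has made one full turn. -/
theorem iterate_tau_compTotal_eq {m n i : ℕ} (hi : 1 ≤ i) (hin : i ≤ n + 1) {a b : TreeSpace k}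
    (ha : a ∈ Dend k (n + 1)) (hb : b ∈ Dend k (m + 1)) (ha' : tau^[n + 2] a = a)
    (hb' : tau^[m + 2] b = b) :
    tau^[n + m + 2] (compTotal k i a b) = compTotal k i a b := by
  -- Read from the right: shifts to the last place of `a`, an exchange, `m` shifts to the last place
  -- of `b`, an exchange, and `i - 1` shifts from place 1 to place `i`.
  have e : n + m + 2 = (i - 1) + (1 + (m + (1 + (n + 1 - i)))) := by omega
  have h1 := iterate_tau_mem ha (n + 1 - i)
  have hb'' : tau (tau^[m.succ] b) = b := by rw [← Function.iterate_succ_apply' tau, hb']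
  rw [e, Function.iterate_add_apply, Function.iterate_add_apply, Function.iterate_add_apply,
    Function.iterate_add_apply, iterate_tau_compTotal hi ha hb _ (by omega),
    show i + (n + 1 - i) = n + 1 by omega, Function.iterate_one, tau_compTotal_last h1 hb,
    iterate_map_neg, map_neg,
    iterate_tau_compTotal le_rfl (tau_mem hb) (tau_mem h1) m (by omega), Nat.add_comm 1 m,
    tau_compTotal_last (iterate_tau_mem (tau_mem hb) m) (tau_mem h1), neg_neg,
    ← Function.iterate_succ_apply tau, hb'',
    iterate_tau_compTotal le_rfl (tau_mem (tau_mem h1)) hb _ (by omega),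
    ← Function.iterate_succ_apply' tau, ← Function.iterate_succ_apply' tau,
    ← Function.iterate_add_apply]
  rw [show i - 1 + (n + 1 - i).succ.succ = n + 2 by omega, ha', show 1 + (i - 1) = i by omega]

theorem tau_unit : tau (𝕐 : TreeSpace k) = -𝕐 := by
  rw [unit_eq, tau_graft, mul_one, tau_one, over_one, ← unit_eq]

theorem tau_prec : tau (tr (.nil △ (.nil △ .nil)) : TreeSpace k) = tr ((.nil △ .nil) △ .nil) := by
  rw [tr_node, tau_graft, mul_one, tau_unit, map_neg, neg_neg, over_tr]
  rfl

theorem unit_mul_unit : (𝕐 ⋆ 𝕐 : TreeSpace k) =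
    tr ((.nil △ .nil) △ .nil) + tr (.nil △ (.nil △ .nil)) := by
  nth_rw 2 [unit_eq]
  rw [unit_mul_graft, mul_one]
  simp

theorem tau_succ : tau (tr ((.nil △ .nil) △ .nil) : TreeSpace k) =
    -(tr (.nil △ (.nil △ .nil)) + tr ((.nil △ .nil) △ .nil)) := by
  rw [tr_node (), tau_graft, tau_one, over_one, unit_mul_unit, add_comm, tr_node () (.nil △ .nil)]

/-- A tree `l △ |` with `l ≠ |` is `≻ ∘₁ l`. -/
theorem compTotal_succ_one {n : ℕ} {x : TreeSpace k} (hx : x ∈ Dend k (n + 1)) :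
    compTotal k 1 (tr ((.nil △ .nil) △ .nil)) x = x ⋎ 𝟙 := by
  rw [tr_node, compTotal_graft_left le_rfl unit_mem, unit_compTotal hx]

/-- A tree `| △ r` with `r ≠ |` is `≺ ∘₂ r`. -/
theorem compTotal_prec_two {n : ℕ} {x : TreeSpace k} (hx : x ∈ Dend k (n + 1)) :
    compTotal k 2 (tr (.nil △ (.nil △ .nil))) x = 𝟙 ⋎ x := by
  rw [tr_node, compTotal_graft_right (i := 1) (n := 0) rfl le_rfl one_mem, unit_compTotal hx]

theorem compTotal_graft_one_last {n : ℕ} {x : TreeSpace k} (hx : x ∈ Dend k n)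
    (y : TreeSpace k) : compTotal k (n + 1) (x ⋎ 𝟙) (𝟙 ⋎ y) = x ⋎ y := by
  rw [compTotal_graft_root rfl hx, mul_one, mul_one]

theorem iterate_tau_tr (N : ℕ) : ∀ T : PTree, T.numNodes = N + 1 →
    tau^[N + 2] (tr T : TreeSpace k) = tr T := by
  induction N using Nat.strong_induction_on with
  | h N ih =>
  have ih' : ∀ n < N, ∀ x ∈ Dend k (n + 1), tau^[n + 2] x = x := by
    intro n hn x hx
    induction x, hx using Dend_induction with
    | zero => exact iterate_map_zero _ _
    | add x y _ _ hx hy => rw [iterate_map_add, hx, hy]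
    | smul s x _ hx => rw [← Module.End.pow_apply] at hx ⊢; rw [map_smul, hx]
    | tree T hT => exact ih n hn T hT
  have h2 : tau^[1 + 2] (tr ((.nil △ .nil) △ .nil) : TreeSpace k) = tr ((.nil △ .nil) △ .nil) := by
    simp only [Function.iterate_succ_apply, Function.iterate_zero, id, tau_succ, map_neg, map_add,
      tau_prec]
    abel
  have h2' : tau^[1 + 2] (tr (.nil △ (.nil △ .nil)) : TreeSpace k) =
      tr (.nil △ (.nil △ .nil)) := by
    simp only [Function.iterate_succ_apply, Function.iterate_zero, id, tau_succ, map_neg, map_add,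
      tau_prec]
    abel
  -- Apart from `Y`, `≺` and `≻`, each shape is a composition of smaller elements: `≺ ∘_2 r`, `≻ ∘_1
  -- l`, or `(l △ |) ∘_last (| △ r)` when both subtrees are nonempty.
  rintro (_ | ⟨_, _ | ⟨_, a, b⟩, _ | ⟨_, c, d⟩⟩) hT
  · simp at hT
  · obtain rfl : N = 0 := by simpa using hT.symm
    change tau^[2] (𝕐 : TreeSpace k) = 𝕐
    simp [Function.iterate_succ_apply, tau_unit]
  · simp only [BinaryTree.numNodes] at hT
    rcases Nat.eq_zero_or_pos (c.numNodes + d.numNodes) with h | h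
    · obtain ⟨rfl, rfl⟩ : c = .nil ∧ d = .nil := by cases c <;> cases d <;> simp_all
      obtain rfl : N = 1 := by simpa using hT.symm
      exact h2'
    · have h3 := iterate_tau_compTotal_eq (n := 1) (m := c.numNodes + d.numNodes) (i := 2)
        (by omega) (by omega) (single_mem_Dend rfl) (tr_mem (c △ d)) h2'
        (ih' _ (by omega) _ (tr_mem (c △ d)))
      rw [compTotal_prec_two (tr_mem (c △ d)), graft_tr] at h3
      rwa [show N = 1 + (c.numNodes + d.numNodes) by omega]
  · simp only [BinaryTree.numNodes] at hT
    rcases Nat.eq_zero_or_pos (a.numNodes + b.numNodes) with h | h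
    · obtain ⟨rfl, rfl⟩ : a = .nil ∧ b = .nil := by cases a <;> cases b <;> simp_all
      obtain rfl : N = 1 := by simpa using hT.symm
      exact h2
    · have h3 := iterate_tau_compTotal_eq (n := 1) (m := a.numNodes + b.numNodes) (i := 1)
        (by omega) (by omega) (single_mem_Dend rfl) (tr_mem (a △ b)) h2
        (ih' _ (by omega) _ (tr_mem (a △ b)))
      rw [compTotal_succ_one (tr_mem (a △ b)), graft_tr] at h3
      rwa [show N = 1 + (a.numNodes + b.numNodes) by omega]
  · simp only [BinaryTree.numNodes] at hT
    have h4 : (tr (a △ b) ⋎ 𝟙 : TreeSpace k) ∈ Dend k (a.numNodes + b.numNodes + 1 + 1) :=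
      graft_mem (by simp only [BinaryTree.numNodes]) (tr_mem (a △ b)) one_mem
    have h5 : (𝟙 ⋎ tr (c △ d) : TreeSpace k) ∈ Dend k (c.numNodes + d.numNodes + 1 + 1) :=
      graft_mem (by simp [BinaryTree.numNodes]) one_mem (tr_mem (c △ d))
    have h3 := iterate_tau_compTotal_eq (i := a.numNodes + b.numNodes + 1 + 1)
      (by omega) le_rfl h4 h5 (ih' _ (by omega) _ h4) (ih' _ (by omega) _ h5)
    rw [compTotal_graft_one_last (n := a.numNodes + b.numNodes + 1) (tr_mem (a △ b)),
      graft_tr] at h3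
    rwa [show N = a.numNodes + b.numNodes + 1 + (c.numNodes + d.numNodes + 1) by omega]

theorem iterate_tau {n : ℕ} {x : TreeSpace k} (hx : x ∈ Dend k (n + 1)) :
    tau^[n + 2] x = x := by
  induction x, hx using Dend_induction with
  | zero => exact iterate_map_zero _ _
  | add x y _ _ hx hy => rw [iterate_map_add, hx, hy]
  | smul s x _ hx => rw [← Module.End.pow_apply] at hx ⊢; rw [map_smul, hx]
  | tree T hT => exact iterate_tau_tr n T hT

variable (k) in
/-- The anticyclic structure map on `𝒴(n + 1)`. -/
def tauEnd (n : ℕ) : Module.End k (Dend k (n + 1)) :=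
  LinearMap.restrict tau fun _ hx => tau_mem hx

@[simp] theorem coe_tauEnd (n : ℕ) (x : Dend k (n + 1)) :
    (tauEnd k n x : TreeSpace k) = tau (x : TreeSpace k) := rfl

theorem coe_tauEnd_pow (n s : ℕ) (x : Dend k (n + 1)) :
    ((tauEnd k n ^ s) x : TreeSpace k) = tau^[s] (x : TreeSpace k) := by
  induction s with
  | zero => rfl
  | succ s ih => rw [pow_succ', Module.End.mul_apply, coe_tauEnd, ih, Function.iterate_succ_apply']

theorem isDendAnticyclic_tauEnd : IsDendAnticyclic (tauEnd k) where
  pow_eq_one n := LinearMap.ext fun x => Subtype.ext <| by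
    rw [coe_tauEnd_pow, iterate_tau x.2]; rfl
  map_unit := Subtype.ext tau_unit
  map_comp_last _ _ a b := tau_compTotal_last a.2 b.2
  map_comp _ _ _ a b hi hin := Subtype.ext (tau_compTotal hi hin a.2 b.2)
  map_prec := Subtype.ext tau_prec
  map_succ := Subtype.ext tau_succ

/-! ### The axioms determine the anticyclic structure. -/

section Uniqueness

variable {τ : ∀ n : ℕ, Module.End k (Dend k (n + 1))}

/-- The axiom with a free degree `N` and an element `x` known only through its value, so that it
applies to a tree without transport along equalities of degrees. -/
theorem IsAnticyclic.apply_comp_last (h : IsAnticyclic τ) {n m N : ℕ} (hN : n + m = N)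
    (a : Dend k (n + 1)) (b : Dend k (m + 1)) (x : Dend k (N + 1))
    (hx : (x : TreeSpace k) = compTotal k (n + 1) a b) :
    (τ N x : TreeSpace k) = -compTotal k 1 (τ m b) (τ n a) := by
  subst hN
  obtain rfl : x = comp (n + 1) a b := Subtype.ext hx
  exact h.map_comp_last n m a b

theorem IsAnticyclic.apply_comp (h : IsAnticyclic τ) {n m N i : ℕ} (hN : n + m = N)
    (hi : 1 ≤ i) (hin : i < n + 1) (a : Dend k (n + 1)) (b : Dend k (m + 1)) (x : Dend k (N + 1))
    (hx : (x : TreeSpace k) = compTotal k i a b) :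
    (τ N x : TreeSpace k) = compTotal k (i + 1) (τ n a) b := by
  subst hN
  obtain rfl : x = comp i a b := Subtype.ext hx
  rw [h.map_comp n m i a b hi hin]
  rfl

/-- For `T ≠ |` the argument is `≻ ∘_1 T`, and `τ(≻) = -(≺ + ≻) = -(Y * Y)`; inserting `T` at place
2 of `Y * Y` gives `Y * T`. -/
theorem IsDendAnticyclic.apply_graft_one (h : IsDendAnticyclic τ) (T : PTree) (n : ℕ)
    (x : Dend k (n + 1)) (hT : T.numNodes = n) (hx : (x : TreeSpace k) = tr T ⋎ 𝟙) :
    (τ n x : TreeSpace k) = -(𝕐 ⋆ tr T) := by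
  subst hT
  rcases T with _ | ⟨_, a, b⟩
  · obtain rfl : x = unitY k := Subtype.ext (by rw [hx, ← unit_eq]; rfl)
    change ((τ 0 (unitY k) : Dend k 1) : TreeSpace k) = _
    rw [h.map_unit, mul_one]
    rfl
  · have hm : (tr (a △ b) : TreeSpace k) ∈ Dend k (a.numNodes + b.numNodes + 1) := tr_mem _
    rw [h.apply_comp (n := 1) (m := a.numNodes + b.numNodes) (i := 1)
      (by simp only [BinaryTree.numNodes]; omega) le_rfl (by omega) (genSucc k) ⟨_, hm⟩ x
      (by rw [hx]; exact (compTotal_succ_one hm).symm), h.map_succ]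
    change compTotal k 2 (-(tr _ + tr _)) _ = _
    rw [add_comm, ← unit_mul_unit, map_neg, LinearMap.neg_apply,
      compTotal_unit_mul le_rfl _ hm, unit_compTotal hm]

theorem IsDendAnticyclic.apply_tr (h : IsDendAnticyclic τ) (T : PTree) : ∀ (n : ℕ)
    (x : Dend k (n + 1)), T.numNodes = n + 1 → (x : TreeSpace k) = tr T →
    (τ n x : TreeSpace k) = tau (tr T) := by
  induction T with
  | nil => intro n x hT; simp at hT
  | node _ a b _ ih =>
  intro n x hT hx
  simp only [BinaryTree.numNodes] at hT
  have hY : (𝕐 ⋆ tr a : TreeSpace k) ∈ Dend k (a.numNodes + 1) :=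
    mul_mem (by omega) unit_mem (tr_mem a)
  rw [tr_node] at hx ⊢
  rw [tau_graft]
  rcases b with _ | ⟨_, c, d⟩
  · rw [tau_one, over_one]
    exact h.apply_graft_one a n x (by simpa using hT) hx
  · have hm : (tr (c △ d) : TreeSpace k) ∈ Dend k (c.numNodes + d.numNodes + 1) := tr_mem _
    have h1 : (tr a ⋎ 𝟙 : TreeSpace k) ∈ Dend k (a.numNodes + 1) :=
      graft_mem rfl (tr_mem a) one_mem
    have h2 : (𝟙 ⋎ tr (c △ d) : TreeSpace k) ∈ Dend k (c.numNodes + d.numNodes + 1 + 1) :=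
      graft_mem (by omega) one_mem hm
    simp only [BinaryTree.numNodes] at hT
    rw [h.apply_comp_last (n := a.numNodes) (m := c.numNodes + d.numNodes + 1) (by omega)
        ⟨_, h1⟩ ⟨_, h2⟩ x (by rw [hx]; exact (compTotal_graft_one_last (tr_mem a) _).symm),
      h.apply_graft_one a _ ⟨_, h1⟩ rfl rfl,
      h.apply_comp_last (n := 1) (m := c.numNodes + d.numNodes) (by omega)
        (genPrec k) ⟨_, hm⟩ ⟨_, h2⟩ (compTotal_prec_two hm).symm,
      h.map_prec, ih (c.numNodes + d.numNodes) ⟨_, hm⟩ rfl rfl]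
    -- Since `≻ = Y / Y`, the inner composition is `Y / tau b` with `b = c △ d`. Inserting `-(Y *
    -- a)` at its first vertex replaces `Y` by `-(Y * a)`.
    change -compTotal k 1 (-compTotal k 1 (tau (tr (c △ d))) (tr ((.nil △ .nil) △ .nil))) _ = _
    have e : (tr ((.nil △ .nil) △ .nil) : TreeSpace k) = 𝕐 ⊘ 𝕐 := by
      rw [over_tr]; rfl
    have hq : tau (tr (c △ d) : TreeSpace k) ∈ Dend k (c.numNodes + d.numNodes + 1) := tau_mem hm
    rw [e, compTotal_one_over _ hq unit_mem, compTotal_one_unit hq, map_neg, map_neg,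
      LinearMap.neg_apply, neg_neg, compTotal_over le_rfl unit_mem, unit_compTotal hY]

end Uniqueness

end Tau

/-! ### Recursive description of Tamari intervals. -/

section TamariOrder

theorem tamari_le_left {l l' : PTree} (r : PTree) (h : Relation.ReflTransGen TamariCover l l') :
    Relation.ReflTransGen TamariCover (l △ r) (l' △ r) :=
  h.lift (fun x => x △ r) fun _ _ => TamariCover.left r

theorem tamari_le_right (l : PTree) {r r' : PTree} (h : Relation.ReflTransGen TamariCover r r') :
    Relation.ReflTransGen TamariCover (l △ r) (l △ r') :=
  h.lift (fun x => l △ x) fun _ _ => TamariCover.right l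

theorem tamari_le_numNodes {S T : PTree} (h : Relation.ReflTransGen TamariCover S T) :
    S.numNodes = T.numNodes := by
  induction h with
  | refl => rfl
  | tail _ h ih => rw [ih, h.numNodes_eq]

/-- The tree `w` is a term of the product `x * (| △ y)`. -/
inductive RightSplit : PTree → PTree → PTree → Prop
  | root (c d : PTree) : RightSplit c d (c △ d)
  | step (c : PTree) {b y d : PTree} : RightSplit b y d → RightSplit (c △ b) y (c △ d)

/-- The tree `w` is a term of the product `(x △ |) * y`. -/
inductive LeftSplit : PTree → PTree → PTree → Prop
  | root (c d : PTree) : LeftSplit c d (c △ d)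
  | step (d : PTree) {x b c : PTree} : LeftSplit x b c → LeftSplit x (b △ d) (c △ d)

theorem RightSplit.numNodes {x y w : PTree} (h : RightSplit x y w) :
    w.numNodes = x.numNodes + y.numNodes + 1 := by
  induction h with
  | root => rfl
  | step c _ ih => simp only [BinaryTree.numNodes, ih]; omega

theorem LeftSplit.numNodes {x y w : PTree} (h : LeftSplit x y w) :
    w.numNodes = x.numNodes + y.numNodes + 1 := by
  induction h with
  | root => rfl
  | step c _ ih => simp only [BinaryTree.numNodes, ih]; omega

/-- The splittings of `w` correspond to the vertices of its right branch, and the degree of `y`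
tells which vertex is used. -/
theorem RightSplit.unique {x y x' y' w : PTree} (h : RightSplit x y w) (h' : RightSplit x' y' w)
    (hy : y.numNodes = y'.numNodes) : x = x' ∧ y = y' := by
  induction h generalizing x' y' with
  | root c d =>
    cases h' with
    | root => exact ⟨rfl, rfl⟩
    | step _ h' => have := h'.numNodes; omega
  | step c h ih =>
    cases h' with
    | root => have := h.numNodes; omega
    | step _ h' => obtain ⟨rfl, rfl⟩ := ih h' hy; exact ⟨rfl, rfl⟩

theorem LeftSplit.unique {x y x' y' w : PTree} (h : LeftSplit x y w) (h' : LeftSplit x' y' w)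
    (hx : x.numNodes = x'.numNodes) : x = x' ∧ y = y' := by
  induction h generalizing x' y' with
  | root c d =>
    cases h' with
    | root => exact ⟨rfl, rfl⟩
    | step _ h' => have := h'.numNodes; omega
  | step c h ih =>
    cases h' with
    | root => have := h.numNodes; omega
    | step _ h' => obtain ⟨rfl, rfl⟩ := ih h' hx; exact ⟨rfl, rfl⟩

theorem RightSplit.le {x y w : PTree} (h : RightSplit x y w) :
    Relation.ReflTransGen TamariCover (x △ y) w := by
  induction h with
  | root => exact .refl
  | step c _ ih => exact .head (.rotate _ _ _) (tamari_le_right c ih)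

theorem LeftSplit.le {x y w : PTree} (h : LeftSplit x y w) :
    Relation.ReflTransGen TamariCover w (x △ y) := by
  induction h with
  | root => exact .refl
  | step d _ ih => exact .tail (tamari_le_left d ih) (.rotate _ _ _)

/-- A rotation of `w` either takes place inside `x` or `y`, or pushes the splitting vertex one step
down the right branch, leaving `x` and `y` unchanged. -/
theorem RightSplit.cover {x y w w' : PTree} (h : RightSplit x y w) (hw : TamariCover w w') :
    ∃ x' y', RightSplit x' y' w' ∧ Relation.ReflTransGen TamariCover x x' ∧
      Relation.ReflTransGen TamariCover y y' := by
  induction h generalizing w' with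
  | root c d =>
    cases hw with
    | rotate a b d => exact ⟨_, _, .step a (.root b d), .refl, .refl⟩
    | left _ h => exact ⟨_, _, .root _ _, .single h, .refl⟩
    | right _ h => exact ⟨_, _, .root _ _, .refl, .single h⟩
  | step c h ih =>
    cases hw with
    | rotate a b d => exact ⟨_, _, .step a (.step b h), .single (.rotate _ _ _), .refl⟩
    | left _ hc => exact ⟨_, _, .step _ h, .single (.left _ hc), .refl⟩
    | right _ hd =>
      obtain ⟨x', y', h1, h2, h3⟩ := ih hd
      exact ⟨_, _, .step c h1, tamari_le_right c h2, h3⟩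

theorem LeftSplit.cover {x y w w' : PTree} (h : LeftSplit x y w) (hw : TamariCover w' w) :
    ∃ x' y', LeftSplit x' y' w' ∧ Relation.ReflTransGen TamariCover x' x ∧
      Relation.ReflTransGen TamariCover y' y := by
  induction h generalizing w' with
  | root c d =>
    cases hw with
    | rotate a b d => exact ⟨_, _, .step d (.root _ b), .refl, .refl⟩
    | left _ h => exact ⟨_, _, .root _ _, .single h, .refl⟩
    | right _ h => exact ⟨_, _, .root _ _, .refl, .single h⟩
  | step c h ih =>
    cases hw with
    | rotate a b d => exact ⟨_, _, .step d (.step b h), .refl, .single (.rotate _ _ _)⟩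
    | right _ hd => exact ⟨_, _, .step _ h, .refl, .single (.right _ hd)⟩
    | left _ hc =>
      obtain ⟨x', y', h1, h2, h3⟩ := ih hc
      exact ⟨_, _, .step c h1, h2, tamari_le_left c h3⟩

/-- The elements of the Tamari order above `l △ r`. -/
theorem node_le_iff {l r w : PTree} : Relation.ReflTransGen TamariCover (l △ r) w ↔
    ∃ x y, RightSplit x y w ∧ Relation.ReflTransGen TamariCover l x ∧
      Relation.ReflTransGen TamariCover r y := by
  refine ⟨fun h => ?_, fun ⟨x, y, h, hx, hy⟩ =>
    ((tamari_le_left r hx).trans (tamari_le_right x hy)).trans h.le⟩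
  induction h with
  | refl => exact ⟨l, r, .root l r, .refl, .refl⟩
  | tail _ h ih =>
    obtain ⟨x, y, h1, hx, hy⟩ := ih
    obtain ⟨x', y', h2, hx', hy'⟩ := h1.cover h
    exact ⟨x', y', h2, hx.trans hx', hy.trans hy'⟩

/-- The elements of the Tamari order below `l △ r`. -/
theorem le_node_iff {l r w : PTree} : Relation.ReflTransGen TamariCover w (l △ r) ↔
    ∃ x y, LeftSplit x y w ∧ Relation.ReflTransGen TamariCover x l ∧
      Relation.ReflTransGen TamariCover y r := by
  refine ⟨fun h => ?_, fun ⟨x, y, h, hx, hy⟩ =>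
    h.le.trans ((tamari_le_left y hx).trans (tamari_le_right l hy))⟩
  induction h using Relation.ReflTransGen.head_induction_on with
  | refl => exact ⟨l, r, .root l r, .refl, .refl⟩
  | head h _ ih =>
    obtain ⟨x, y, h1, hx, hy⟩ := ih
    obtain ⟨x', y', h2, hx', hy'⟩ := h1.cover h
    exact ⟨x', y', h2, hx'.trans hx, hy'.trans hy⟩

/-- The terms of `x * (| △ y)`. -/
def rightTerms (y : PTree) : PTree → Finset PTree
  | .nil => {.nil △ y}
  | .node _ a b => insert ((a △ b) △ y) ((rightTerms y b).image (a △ ·))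

/-- The terms of `(x △ |) * y`. -/
def leftTerms (x : PTree) : PTree → Finset PTree
  | .nil => {x △ .nil}
  | .node _ c d => insert (x △ (c △ d)) ((leftTerms x c).image (· △ d))

theorem mem_rightTerms {x y w : PTree} : w ∈ rightTerms y x ↔ RightSplit x y w := by
  induction x generalizing w with
  | nil =>
    rw [rightTerms, Finset.mem_singleton]
    exact ⟨fun h => h ▸ .root _ _, fun h => by cases h; rfl⟩
  | node _ a b _ ih =>
    rw [rightTerms, Finset.mem_insert, Finset.mem_image]
    constructor
    · rintro (rfl | ⟨d, hd, rfl⟩)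
      · exact .root _ _
      · exact .step a (ih.1 hd)
    · intro h
      cases h with
      | root => exact Or.inl rfl
      | step _ h => exact Or.inr ⟨_, ih.2 h, rfl⟩

theorem mem_leftTerms {x y w : PTree} : w ∈ leftTerms x y ↔ LeftSplit x y w := by
  induction y generalizing w with
  | nil =>
    rw [leftTerms, Finset.mem_singleton]
    exact ⟨fun h => h ▸ .root _ _, fun h => by cases h; rfl⟩
  | node _ c d ih _ =>
    rw [leftTerms, Finset.mem_insert, Finset.mem_image]
    constructor
    · rintro (rfl | ⟨d, hd, rfl⟩)
      · exact .root _ _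
      · exact .step _ (ih.1 hd)
    · intro h
      cases h with
      | root => exact Or.inl rfl
      | step _ h => exact Or.inr ⟨_, ih.2 h, rfl⟩

open Classical in
/-- The trees above `v` in the Tamari order. -/
def upTrees (v : PTree) : Finset PTree :=
  {w ∈ BinaryTree.treesOfNumNodesEq v.numNodes | Relation.ReflTransGen TamariCover v w}

open Classical in
/-- The trees below `v` in the Tamari order. -/
def downTrees (v : PTree) : Finset PTree :=
  {w ∈ BinaryTree.treesOfNumNodesEq v.numNodes | Relation.ReflTransGen TamariCover w v}

theorem mem_upTrees {v w : PTree} : w ∈ upTrees v ↔ Relation.ReflTransGen TamariCover v w := by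
  classical
  rw [upTrees, Finset.mem_filter, BinaryTree.mem_treesOfNumNodesEq]
  exact ⟨fun h => h.2, fun h => ⟨(tamari_le_numNodes h).symm, h⟩⟩

theorem mem_downTrees {v w : PTree} : w ∈ downTrees v ↔ Relation.ReflTransGen TamariCover w v := by
  classical
  rw [downTrees, Finset.mem_filter, BinaryTree.mem_treesOfNumNodesEq]
  exact ⟨fun h => h.2, fun h => ⟨tamari_le_numNodes h, h⟩⟩

end TamariOrder

/-! ### Interval sums and the Coxeter transformation. -/

section Coxeter

variable {k : Type*} [Field k]

/-- All terms have coefficient one: those in which the root of `x` stays the root have a right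
subtree of degree greater than that of `y`, so they differ from `x △ y`. -/
theorem mul_graft_eq_sum (x y : PTree) :
    (tr x ⋆ (𝟙 ⋎ tr y) : TreeSpace k) = ∑ w ∈ rightTerms y x, tr w := by
  induction x with
  | nil => rw [rightTerms, Finset.sum_singleton, one_mul, graft_tr]
  | node _ a b _ ih =>
    rw [rightTerms, Finset.sum_insert, Finset.sum_image, tr_node, graft_mul_graft, ih, mul_one,
      map_sum]
    · simp only [graft_tr]
    · intro c _ d _ h
      exact (BinaryTree.node.inj h).2.2
    · rw [Finset.mem_image]
      rintro ⟨w, hw, h⟩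
      obtain rfl := (BinaryTree.node.inj h).2.2
      have := (mem_rightTerms.1 hw).numNodes
      omega

theorem graft_mul_eq_sum (x y : PTree) :
    ((tr x ⋎ 𝟙) ⋆ tr y : TreeSpace k) = ∑ w ∈ leftTerms x y, tr w := by
  induction y with
  | nil => rw [leftTerms, Finset.sum_singleton, mul_one, graft_tr]
  | node _ c d ih _ =>
    rw [leftTerms, Finset.sum_insert, Finset.sum_image, tr_node, graft_mul_graft, ih, one_mul,
      map_sum, LinearMap.sum_apply, add_comm]
    · simp only [graft_tr]
    · intro c _ d _ h
      exact (BinaryTree.node.inj h).2.1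
    · rw [Finset.mem_image]
      rintro ⟨w, hw, h⟩
      obtain rfl := (BinaryTree.node.inj h).2.1
      have := (mem_leftTerms.1 hw).numNodes
      omega

variable (k) in
/-- The sum of the trees above `v` in the Tamari order. -/
def upSum (v : PTree) : TreeSpace k := ∑ w ∈ upTrees v, tr w

variable (k) in
/-- The sum of the trees below `v` in the Tamari order. -/
def downSum (v : PTree) : TreeSpace k := ∑ w ∈ downTrees v, tr w

theorem upSum_nil : upSum k .nil = 𝟙 := by
  have : upTrees .nil = {.nil} := by
    ext w
    rw [mem_upTrees, Finset.mem_singleton]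
    refine ⟨fun h => ?_, fun h => h ▸ .refl⟩
    have := tamari_le_numNodes h
    cases w
    · rfl
    · simp [BinaryTree.numNodes] at this
  rw [upSum, this, Finset.sum_singleton]

theorem downSum_nil : downSum k .nil = 𝟙 := by
  have : downTrees .nil = {.nil} := by
    ext w
    rw [mem_downTrees, Finset.mem_singleton]
    refine ⟨fun h => ?_, fun h => h ▸ .refl⟩
    have := tamari_le_numNodes h
    cases w
    · rfl
    · simp [BinaryTree.numNodes] at this
  rw [downSum, this, Finset.sum_singleton]

/-- By `node_le_iff` the upper interval is the union of the term sets of `x * (| △ y)` over `x ≥ l`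
and `y ≥ r`. The union is disjoint, since the degree of `y` is fixed and a splitting is then unique.
-/
theorem upSum_node (l r : PTree) : upSum k (l △ r) = upSum k l ⋆ (𝟙 ⋎ upSum k r) := by
  have h : upTrees (l △ r) = (upTrees l ×ˢ upTrees r).biUnion fun p => rightTerms p.2 p.1 := by
    ext w
    simp only [mem_upTrees, node_le_iff, Finset.mem_biUnion, Finset.mem_product, mem_rightTerms,
      Prod.exists]
    exact exists₂_congr fun _ _ => and_comm
  rw [upSum, h, Finset.sum_biUnion, Finset.sum_product]
  · simp only [upSum, map_sum, LinearMap.sum_apply, mul_graft_eq_sum]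
    rw [Finset.sum_comm]
  · rintro ⟨x, y⟩ hp ⟨x', y'⟩ hp' hne
    simp only [Finset.coe_product, Set.mem_prod, Finset.mem_coe, mem_upTrees] at hp hp'
    refine Finset.disjoint_left.2 fun w hw hw' => hne ?_
    have hy : r.numNodes = y.numNodes := tamari_le_numNodes hp.2
    have hy' : r.numNodes = y'.numNodes := tamari_le_numNodes hp'.2
    obtain ⟨rfl, rfl⟩ := (mem_rightTerms.1 hw).unique (mem_rightTerms.1 hw')
      (hy.symm.trans hy')
    rfl

theorem downSum_node (l r : PTree) :
    downSum k (l △ r) = (downSum k l ⋎ 𝟙) ⋆ downSum k r := by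
  have h : downTrees (l △ r) =
      (downTrees l ×ˢ downTrees r).biUnion fun p => leftTerms p.1 p.2 := by
    ext w
    simp only [mem_downTrees, le_node_iff, Finset.mem_biUnion, Finset.mem_product, mem_leftTerms,
      Prod.exists]
    exact exists₂_congr fun _ _ => and_comm
  rw [downSum, h, Finset.sum_biUnion, Finset.sum_product]
  · simp only [downSum, map_sum, LinearMap.sum_apply, graft_mul_eq_sum]
    rw [Finset.sum_comm]
  · rintro ⟨x, y⟩ hp ⟨x', y'⟩ hp' hne
    simp only [Finset.coe_product, Set.mem_prod, Finset.mem_coe, mem_downTrees] at hp hp'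
    refine Finset.disjoint_left.2 fun w hw hw' => hne ?_
    have hx : x.numNodes = l.numNodes := tamari_le_numNodes hp.1
    have hx' : x'.numNodes = l.numNodes := tamari_le_numNodes hp'.1
    obtain ⟨rfl, rfl⟩ := (mem_leftTerms.1 hw).unique (mem_leftTerms.1 hw')
      (hx.trans hx'.symm)
    rfl

theorem sum_treeOfDegree {M : Type*} [AddCommMonoid M] (n : ℕ) (f : PTree → M) :
    ∑ w : TreeOfDegree n, f w.1 = ∑ w ∈ BinaryTree.treesOfNumNodesEq n, f w :=
  (Finset.sum_subtype (p := fun T => T ∈ {T : PTree | T.numNodes = n}) _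
    (fun _ => BinaryTree.mem_treesOfNumNodesEq) f).symm

theorem coe_sum_zetaMatrix_row {n : ℕ} (v : TreeOfDegree n) :
    ((∑ w, zetaMatrix k (TreeOfDegree n) v w • treeBasis k n w : Dend k n) : TreeSpace k) =
      upSum k v.1 := by
  classical
  obtain ⟨v, rfl⟩ := v
  rw [upSum, upTrees, Finset.sum_filter, ← sum_treeOfDegree, AddSubmonoidClass.coe_finsetSum]
  refine Finset.sum_congr rfl fun w _ => ?_
  rw [treeBasis_apply]
  change (((if Relation.ReflTransGen TamariCover v w.1 then (1 : k) else 0) •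
    ofTree k w.1 w.2 : Dend k _) : TreeSpace k) = _
  split_ifs <;> simp [ofTree]

theorem coe_sum_zetaMatrix_col {n : ℕ} (v : TreeOfDegree n) :
    ((∑ w, zetaMatrix k (TreeOfDegree n) w v • treeBasis k n w : Dend k n) : TreeSpace k) =
      downSum k v.1 := by
  classical
  obtain ⟨v, rfl⟩ := v
  rw [downSum, downTrees, Finset.sum_filter, ← sum_treeOfDegree, AddSubmonoidClass.coe_finsetSum]
  refine Finset.sum_congr rfl fun w _ => ?_
  rw [treeBasis_apply]
  change (((if Relation.ReflTransGen TamariCover w.1 v then (1 : k) else 0) •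
    ofTree k w.1 w.2 : Dend k _) : TreeSpace k) = _
  split_ifs <;> simp [ofTree]

/-- The Coxeter transformation exchanges, up to sign, the sums over upper and lower intervals. -/
theorem theta_sum_zetaMatrix {n : ℕ} (v : TreeOfDegree n) :
    theta k n (∑ w, zetaMatrix k (TreeOfDegree n) v w • treeBasis k n w) =
      -∑ w, zetaMatrix k (TreeOfDegree n) w v • treeBasis k n w := by
  have h1 : Matrix.toLin (treeBasis k n) (treeBasis k n)
      (zetaMatrix k (TreeOfDegree n)).transpose (treeBasis k n v) =
        ∑ w, zetaMatrix k (TreeOfDegree n) v w • treeBasis k n w := Matrix.toLin_self _ _ _ _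
  have h2 : coxeterMatrix k (TreeOfDegree n) * (zetaMatrix k (TreeOfDegree n)).transpose =
      -zetaMatrix k (TreeOfDegree n) := by
    rw [coxeterMatrix, Matrix.neg_mul, Matrix.mul_assoc, Matrix.nonsing_inv_mul, Matrix.mul_one]
    rw [Matrix.det_transpose, det_zetaMatrix]
    exact isUnit_one
  rw [← h1, theta, ← Matrix.toLin_mul_apply, h2, Matrix.toLin_self]
  apply Subtype.ext
  rw [Submodule.coe_neg, AddSubmonoidClass.coe_finsetSum, AddSubmonoidClass.coe_finsetSum,
    ← Finset.sum_neg_distrib]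
  refine Finset.sum_congr rfl fun w _ => ?_
  rw [Submodule.coe_smul, Submodule.coe_smul, ← neg_smul]
  rfl

/-- The upper sums are the columns of `Lᵗ`, which is invertible. Identities linear in an element can
therefore be checked on them. -/
theorem Dend_le_span_upSum (n : ℕ) :
    Dend k n ≤ Submodule.span k (upSum k '' {v | v.numNodes = n}) := by
  intro x hx
  induction x, hx using Dend_induction with
  | zero => exact Submodule.zero_mem _
  | add x y _ _ hx hy => exact Submodule.add_mem _ hx hy
  | smul c x _ hx => exact Submodule.smul_mem _ c hx
  | tree T hT =>
    let v : TreeOfDegree n := ⟨T, hT⟩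
    -- The basis vector at `v` is `Lᵗ` applied to `(Lᵗ)⁻¹ e_v`; expanding the latter in the basis
    -- exhibits it as a combination of upper sums.
    have h1 : Matrix.toLin (treeBasis k n) (treeBasis k n)
        ((zetaMatrix k (TreeOfDegree n)).transpose *
          (zetaMatrix k (TreeOfDegree n)).transpose⁻¹) (treeBasis k n v) = treeBasis k n v := by
      rw [Matrix.mul_nonsing_inv, Matrix.toLin_one, LinearMap.id_apply]
      rw [Matrix.det_transpose, det_zetaMatrix]
      exact isUnit_one
    have h2 : (tr T : TreeSpace k) = (treeBasis k n v : Dend k n) := by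
      rw [treeBasis_apply]; rfl
    rw [h2, ← h1, Matrix.toLin_mul_apply (treeBasis k n) (treeBasis k n), Matrix.toLin_self,
      map_sum, AddSubmonoidClass.coe_finsetSum]
    refine Submodule.sum_mem _ fun w _ => ?_
    rw [map_smul, Submodule.coe_smul, Matrix.toLin_self]
    refine Submodule.smul_mem _ _ (Submodule.subset_span ⟨w.1, w.2, ?_⟩)
    exact (coe_sum_zetaMatrix_row w).symm

@[elab_as_elim]
theorem Dend_upSum_induction {n : ℕ} {P : TreeSpace k → Prop} (zero : P 0)
    (add : ∀ x y, P x → P y → P (x + y)) (smul : ∀ (c : k) x, P x → P (c • x))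
    (upSum : ∀ v : PTree, v.numNodes = n → P (upSum k v)) {x : TreeSpace k}
    (hx : x ∈ Dend k n) : P x := by
  have h := Dend_le_span_upSum n hx
  clear hx
  induction h using Submodule.span_induction with
  | mem x h => obtain ⟨v, hv, rfl⟩ := h; exact upSum v hv
  | zero => exact zero
  | add x y _ _ hx hy => exact add x y hx hy
  | smul c x _ hx => exact smul c x hx

@[elab_as_elim]
theorem upSum_induction {P : TreeSpace k → Prop} (x : TreeSpace k) (zero : P 0)
    (add : ∀ x y, P x → P y → P (x + y)) (smul : ∀ (c : k) x, P x → P (c • x))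
    (upSum : ∀ v : PTree, P (upSum k v)) : P x := by
  induction x using treeSpace_induction with
  | zero => exact zero
  | add x y hx hy => exact add x y hx hy
  | smul c x hx => exact smul c x hx
  | tree T => exact Dend_upSum_induction zero add smul (fun v _ => upSum v) (tr_mem T)

/-- The opposite of the Coxeter transformation, on the space of all trees. -/
def cox : TreeSpace k →ₗ[k] TreeSpace k :=
  Finsupp.linearCombination k fun T => -(theta k T.numNodes (ofTree k T rfl) : TreeSpace k)

theorem cox_tr {n : ℕ} (T : PTree) (hT : T.numNodes = n) :
    cox (tr T : TreeSpace k) = -(theta k n (ofTree k T hT) : TreeSpace k) := by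
  subst hT
  simp [cox]

theorem cox_coe {n : ℕ} (x : Dend k n) : cox (x : TreeSpace k) = -(theta k n x : TreeSpace k) := by
  obtain ⟨x, hx⟩ := x
  induction x, hx using Dend_induction with
  | zero =>
    change cox 0 = -((theta k n 0 : Dend k n) : TreeSpace k)
    simp
  | add x y h1 h2 hx hy =>
    change cox (x + y) = -((theta k n (⟨x, h1⟩ + ⟨y, h2⟩) : Dend k n) : TreeSpace k)
    rw [map_add, map_add, hx, hy, Submodule.coe_add, neg_add]
  | smul c x h1 hx =>
    change cox (c • x) = -((theta k n (c • ⟨x, h1⟩) : Dend k n) : TreeSpace k)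
    rw [map_smul, map_smul, hx, Submodule.coe_smul, smul_neg]
  | tree T hT =>
    exact cox_tr T hT

theorem cox_upSum_coe {n : ℕ} (v : TreeOfDegree n) : cox (upSum k v.1) = downSum k v.1 := by
  rw [← coe_sum_zetaMatrix_row v, cox_coe, theta_sum_zetaMatrix v, Submodule.coe_neg, neg_neg,
    coe_sum_zetaMatrix_col]

theorem cox_upSum (v : PTree) : cox (upSum k v) = downSum k v :=
  cox_upSum_coe (n := v.numNodes) ⟨v, rfl⟩

/-! ### How -θ transforms the products, and its square. -/

theorem cox_one : cox (𝟙 : TreeSpace k) = 𝟙 := by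
  rw [← upSum_nil, cox_upSum, downSum_nil, upSum_nil]

/-- On interval sums this is the comparison of the factorisations `upSum_node` and `downSum_node`;
both sides are bilinear. -/
theorem cox_mul_graft (x y : TreeSpace k) : cox (x ⋆ (𝟙 ⋎ y)) = (cox x ⋎ 𝟙) ⋆ cox y := by
  induction x using upSum_induction with
  | zero => simp
  | add x y hx hy => simp only [map_add, LinearMap.add_apply, hx, hy]
  | smul s x hx => simp only [map_smul, LinearMap.smul_apply, hx]
  | upSum l =>
  induction y using upSum_induction with
  | zero => simp
  | add x y hx hy => simp only [map_add, hx, hy]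
  | smul s x hx => simp only [map_smul, hx]
  | upSum r => rw [← upSum_node, cox_upSum, cox_upSum, cox_upSum, downSum_node]

/-- Induction on the left subtree of `v`: associativity absorbs `x` into the left factor of
`upSum_node`, and `over_mul_graft` pulls `cox x` back out. -/
theorem cox_mul (x y : TreeSpace k) : cox (x ⋆ y) = cox x ⊘ cox y := by
  induction y using upSum_induction with
  | zero => simp
  | add x y hx hy => simp only [map_add, hx, hy]
  | smul s x hx => simp only [map_smul, hx]
  | upSum v =>
  induction v with
  | nil => rw [upSum_nil, mul_one, cox_one, over_one]
  | node _ l r ih _ =>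
    rw [upSum_node, ← mul_assoc, cox_mul_graft, cox_mul_graft, ih, over_mul_graft]

theorem cox_under (x y : TreeSpace k) : cox (graftUnder x y) = cox x ⋆ cox y := by
  induction x using upSum_induction with
  | zero => simp
  | add x y hx hy => simp only [map_add, LinearMap.add_apply, hx, hy]
  | smul s x hx => simp only [map_smul, LinearMap.smul_apply, hx]
  | upSum v =>
  induction v with
  | nil => rw [upSum_nil, one_under, cox_one, one_mul]
  | node _ l r _ ih =>
    rw [upSum_node, under_mul_graft, cox_mul_graft, cox_mul_graft, ih, mul_assoc]

/-- This carries the sign of the theorem: each vertex contributes a factor -1, because applying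
`cox` to a difference of a `*` product and a `\` product gives the corresponding `/` product minus
the `*` product. -/
theorem cox_downSum_graft (v : PTree) :
    cox (downSum k v ⋎ 𝟙) = (-1 : k) ^ v.numNodes • (𝟙 ⋎ upSum k v) := by
  induction v with
  | nil =>
    have h := cox_mul_graft (𝟙 : TreeSpace k) 𝟙
    rw [one_mul, cox_one, mul_one] at h
    rw [downSum_nil, upSum_nil, h]
    simp
  | node _ l r ihl ihr =>
    -- The product recursion for `(D_l △ |) * (D_r △ |)` has two terms: the one wanted, and `D_l △
    -- (D_r △ |)`, which is the `\` product. Both products are handled by `cox_mul` and `cox_under`.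
    have h1 : (downSum k (l △ r) ⋎ 𝟙 : TreeSpace k) =
        (downSum k l ⋎ 𝟙) ⋆ (downSum k r ⋎ 𝟙) -
          graftUnder (downSum k l ⋎ 𝟙) (downSum k r ⋎ 𝟙) := by
      rw [downSum_node, graft_mul_graft, one_mul, under_graft, one_under, add_sub_cancel_right]
    rw [h1, map_sub, cox_mul, cox_under, ihl, ihr, upSum_node]
    simp only [map_smul, LinearMap.smul_apply, over_graft, over_one, graft_mul_graft, mul_one,
      BinaryTree.numNodes, pow_add, smul_add, smul_smul]
    module

/-- The anticyclic structure map is, up to sign, the square of the Coxeter transformation. -/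
theorem tau_eq_cox_cox {n : ℕ} {x : TreeSpace k} (hx : x ∈ Dend k n) :
    tau x = (-1 : k) ^ n • cox (cox x) := by
  refine Dend_upSum_induction (P := fun x => tau x = (-1 : k) ^ n • cox (cox x)) (by simp)
    (fun x y hx hy => by simp only [map_add, hx, hy, smul_add])
    (fun s x hx => by simp only [map_smul, hx, smul_comm s]) (fun v hv => ?_) hx
  subst hv
  clear hx
  induction v with
  | nil => rw [upSum_nil, tau_one, cox_one, cox_one]; simp
  | node _ l r _ ih =>
    -- With `x = upSum l` and `y = upSum r`, the left side becomes `-((| △ x) / tau y)`. On the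
    -- right, `cox (cox x △ |)` is `| △ x` up to the sign `(-1)^(deg l)`, so only signs remain to be
    -- compared.
    rw [upSum_node, tau_mul_graft, cox_mul_graft, cox_mul, ih, mul_one, cox_upSum l,
      cox_downSum_graft]
    simp only [map_smul, LinearMap.smul_apply, BinaryTree.numNodes, pow_add, smul_smul, pow_one]
    rw [← neg_smul]
    congr 1
    have h : ((-1 : k) ^ l.numNodes) * (-1) ^ l.numNodes = 1 := by
      rw [← mul_pow]; simp
    linear_combination (-(-1 : k) ^ r.numNodes) * h.symm

theorem IsDendAnticyclic.coe_apply {τ : ∀ n : ℕ, Module.End k (Dend k (n + 1))}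
    (h : IsDendAnticyclic τ) (n : ℕ) (x : Dend k (n + 1)) :
    (τ n x : TreeSpace k) = tau (x : TreeSpace k) := by
  obtain ⟨x, hx⟩ := x
  induction x, hx using Dend_induction with
  | zero =>
    change ((τ n 0 : Dend k (n + 1)) : TreeSpace k) = tau 0
    simp
  | add x y h1 h2 hx hy =>
    change ((τ n (⟨x, h1⟩ + ⟨y, h2⟩) : Dend k (n + 1)) : TreeSpace k) = tau (x + y)
    rw [map_add, map_add, Submodule.coe_add, hx, hy]
  | smul c x h1 hx =>
    change ((τ n (c • ⟨x, h1⟩) : Dend k (n + 1)) : TreeSpace k) = tau (c • x)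
    rw [map_smul, map_smul, Submodule.coe_smul, hx]
  | tree T hT => exact h.apply_tr T n _ hT rfl

theorem IsDendAnticyclic.eq_tauEnd {τ : ∀ n : ℕ, Module.End k (Dend k (n + 1))}
    (h : IsDendAnticyclic τ) : τ = tauEnd k :=
  funext fun n => LinearMap.ext fun x => Subtype.ext (h.coe_apply n x)

theorem tauEnd_eq_theta_sq (n : ℕ) :
    tauEnd k n = (-1 : k) ^ (n + 1) • theta k (n + 1) ^ 2 := by
  refine LinearMap.ext fun x => Subtype.ext ?_
  rw [coe_tauEnd, tau_eq_cox_cox x.2, cox_coe, map_neg, cox_coe, neg_neg, pow_two (theta k _)]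
  rfl

end Coxeter

end DendTamari

end

/-- There is exactly one anticyclic structure `τ` on the dendriform operad with `τ(≺) = ≻` and
`τ(≻) = -(≺ + ≻)`, and it is given on `𝒴(n)`, for every `n ≥ 1`, by `(-1)^n θ²`. -/
theorem theorem6p1 (k : Type*) [Field k] :
    (∃! τ : ∀ n : ℕ, Module.End k (DendTamari.Dend k (n + 1)), DendTamari.IsDendAnticyclic τ) ∧
    ∀ τ : ∀ n : ℕ, Module.End k (DendTamari.Dend k (n + 1)), DendTamari.IsDendAnticyclic τ →
      ∀ n : ℕ, τ n = (-1 : k) ^ (n + 1) • DendTamari.theta k (n + 1) ^ 2 := by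
  refine ⟨⟨DendTamari.tauEnd k, DendTamari.isDendAnticyclic_tauEnd, fun τ h => h.eq_tauEnd⟩,
    fun τ h n => ?_⟩
  rw [h.eq_tauEnd, DendTamari.tauEnd_eq_theta_sq]
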